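/- Let $\mathsf{k}$ be an algebraically closed field of characteristic zero and let $H$ be a finite-dimensional $\mathsf{k}$-vector space with a non-degenerate symmetric bilinear form $q$. Let $\mathcal{C}=\mathcal{C}\ell(H,q)$ be its Clifford algebra, with relations $x\cdot x=q(x,x)$ for $x\in H$, let $\alpha$ be its parity involution, let $\beta$ be its antiautomorphism that reverses the order of products of elements of $H$, and put $\bar a=\alpha(\beta(a))$. Let $V$ be a $\mathcal{C}$-module with $\dim_{\mathsf{k}}V=4n$, and let $\tau$ be a non-degenerate symmetric bilinear form on $V$ that is $\mathcal{C}$-invariant, i.e. $\tau(au,v)=\tau(u,\bar a v)$ for all $a\in\mathcal{C}$ and $u,v\in V$. For $x\in H$ let $\omega_x\in\Lambda^2V^*$ be the form $\omega_x(u,v)=\tau(xu,v)$, let $W\subset\Lambda^2V^*$ be the image of the linear map $\varphi\colon H\to\Lambda^2V^*$, $x\mapsto\omega_x$, and let $A^\bullet\subset\Lambda^\bullet V^*$ be the subalgebra generated by $W$, with the grading induced from $\Lambda^\bullet V^*$. The $n$-th $F$-algebra of $H$ is defined as follows. Identify $H^*$ with $H$ by means of $q$, so that $q$ becomes an element of $S^2H$,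 and equip each $S^mH$ with the non-degenerate symmetric pairing induced by $q$, $\langle x_1\cdots x_m,y_1\cdots y_m\rangle=\sum_{\sigma\in\mathfrak{S}_m}\prod_i q(x_i,y_{\sigma(i)})$. For $r\ge 0$ let $R_{n,r}\subset S^{n+r}H$ be the orthogonal complement of $q^r\cdot S^{n-r}H$, where $S^jH=0$ for $j<0$ (so $R_{n,r}=S^{n+r}H$ for $r>n$). Let $F_n^\bullet(H)$ be the quotient of $S^\bullet H$ by the ideal generated by $\bigcup_{r\ge0}R_{n,r}$, graded so that $F_n^{2i}(H)$ is the image of $S^iH$ and the components of odd degree are zero. Then there is an isomorphism of graded $\mathsf{k}$-algebras $F_n^\bullet(H)\simeq A^\bullet$ that sends the class of $x$ to $\omega_x$ for every $x\in H$. Moreover, if $\dim H\neq 1$, then the ideal of $S^\bullet H$ that defines $F_n^\bullet(H)$ is generated by the elements $x^{n+1}$ with $x\in H$, $q(x,x)=0$, so that $$A^\bullet\simeq F_n^\bullet(H)=S^\bullet H\,/\,\langle x^{n+1}\mid x\in H,\ q(x,x)=0\rangle .$$ -/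

import Mathlib

noncomputable section

namespace FAlg

section Sym

variable {k : Type*} [Field k] {H : Type*} [AddCommGroup H] [Module k H]

/-- The homogeneous component `S^i H` of the symmetric algebra `S^• H`. -/
def symPart (k : Type*) [Field k] (H : Type*) [AddCommGroup H] [Module k H] (i : ℕ) :
    Submodule k (SymmetricAlgebra k H) :=
  LinearMap.range (SymmetricAlgebra.ι k H) ^ i

/-- Two derivations of `S^• H` that agree on `H` are equal. -/
theorem derivation_ext {D₁ D₂ : Derivation k (SymmetricAlgebra k H) (SymmetricAlgebra k H)}
    (h : ∀ x, D₁ (SymmetricAlgebra.ι k H x) = D₂ (SymmetricAlgebra.ι k H x)) : D₁ = D₂ := by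
  ext a
  induction a using SymmetricAlgebra.induction with
  | algebraMap r => simp
  | ι x => exact h x
  | mul a b ha hb => simp [ha, hb]
  | add a b ha hb => simp [ha, hb]

/-- Auxiliary homomorphism `S^• H → S^• H ⊕ ε S^• H`, `x ↦ x + ε f(x)`, for a linear form `f`. -/
def dualHom (f : Module.Dual k H) :
    SymmetricAlgebra k H →ₐ[k] TrivSqZeroExt (SymmetricAlgebra k H) (SymmetricAlgebra k H) :=
  SymmetricAlgebra.lift
    ((TrivSqZeroExt.inlAlgHom k (SymmetricAlgebra k H) (SymmetricAlgebra k H)).toLinearMap ∘ₗ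
        SymmetricAlgebra.ι k H +
      (TrivSqZeroExt.inrHom (SymmetricAlgebra k H) (SymmetricAlgebra k H)).restrictScalars k ∘ₗ
        Algebra.linearMap k (SymmetricAlgebra k H) ∘ₗ f)

theorem dualHom_ι (f : Module.Dual k H) (x : H) :
    dualHom f (SymmetricAlgebra.ι k H x) =
      TrivSqZeroExt.inl (SymmetricAlgebra.ι k H x) +
        TrivSqZeroExt.inr (algebraMap k (SymmetricAlgebra k H) (f x)) := by
  simp [dualHom]

theorem fst_dualHom (f : Module.Dual k H) (a : SymmetricAlgebra k H) :
    (dualHom f a).fst = a := by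
  induction a using SymmetricAlgebra.induction with
  | algebraMap r => simp [AlgHom.commutes, TrivSqZeroExt.algebraMap_eq_inl']
  | ι x => simp [dualHom_ι]
  | mul a b ha hb => simp [ha, hb]
  | add a b ha hb => simp [ha, hb]

/-- The derivation of `S^• H` extending a linear form `f` on `H`. -/
def derivOfForm (f : Module.Dual k H) :
    Derivation k (SymmetricAlgebra k H) (SymmetricAlgebra k H) :=
  Derivation.mk'
    ((TrivSqZeroExt.sndHom (SymmetricAlgebra k H) (SymmetricAlgebra k H)).restrictScalars k ∘ₗ
      (dualHom f).toLinearMap)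
    (by
      intro a b
      simp [fst_dualHom, mul_comm])

@[simp]
theorem derivOfForm_ι (f : Module.Dual k H) (x : H) :
    derivOfForm f (SymmetricAlgebra.ι k H x) = algebraMap k (SymmetricAlgebra k H) (f x) := by
  simp [derivOfForm, dualHom_ι, Algebra.algebraMap_eq_smul_one]

/-- For `x : H`, the derivation `∂_x` of `S^• H` with `∂_x y = q(x, y)` for `y : H`, as an
endomorphism of the vector space `S^• H` that depends linearly on `x`. -/
def contract (q : LinearMap.BilinForm k H) : H →ₗ[k] Module.End k (SymmetricAlgebra k H) where
  toFun x := (derivOfForm (q x)).toLinearMap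
  map_add' x y := by
    rw [show derivOfForm (q (x + y)) = derivOfForm (q x) + derivOfForm (q y) from
      derivation_ext (by simp)]
    rfl
  map_smul' c x := by
    rw [show derivOfForm (q (c • x)) = c • derivOfForm (q x) from
      derivation_ext (by simp [Algebra.smul_def])]
    rfl

@[simp]
theorem contract_ι (q : LinearMap.BilinForm k H) (x y : H) :
    contract q x (SymmetricAlgebra.ι k H y) = algebraMap k _ (q x y) :=
  derivOfForm_ι _ _

theorem contract_mul (q : LinearMap.BilinForm k H) (x : H) (a b : SymmetricAlgebra k H) :
    contract q x (a * b) = a * contract q x b + b * contract q x a := by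
  exact (derivOfForm (q x)).leibniz a b

theorem contract_comm (q : LinearMap.BilinForm k H) (x y : H) :
    contract q x * contract q y = contract q y * contract q x := by
  have h : ⁅derivOfForm (q x), derivOfForm (q y)⁆ = 0 := derivation_ext (by
    intro z
    simp [Derivation.commutator_apply])
  ext a
  have := DFunLike.congr_fun h a
  rw [Derivation.commutator_apply] at this
  exact sub_eq_zero.mp this

/-- The commutative algebra generated by the operators `∂_x`. -/
def contractAlg (q : LinearMap.BilinForm k H) :
    Subalgebra k (Module.End k (SymmetricAlgebra k H)) :=
  Algebra.adjoin k (Set.range (contract q))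

instance (q : LinearMap.BilinForm k H) : CommRing (contractAlg q) where
  __ := (contractAlg q).toRing
  mul_comm := by
    have := Algebra.isMulCommutative_adjoin k (s := Set.range (contract q)) (by
      rintro _ ⟨x, rfl⟩ _ ⟨y, rfl⟩
      exact contract_comm q x y)
    exact this.is_comm.comm

/-- The linear map `x ↦ ∂_x` into this algebra. -/
def contractMap (q : LinearMap.BilinForm k H) : H →ₗ[k] contractAlg q where
  toFun x := ⟨contract q x, Algebra.subset_adjoin ⟨x, rfl⟩⟩
  map_add' x y := Subtype.ext (map_add _ x y)
  map_smul' c x := Subtype.ext (map_smul _ c x)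

/-- The action of `S^• H` on itself by constant coefficient differential operators:
`x₁ ⋯ x_m` acts as `∂_{x₁} ⋯ ∂_{x_m}`. -/
def diffOp (q : LinearMap.BilinForm k H) :
    SymmetricAlgebra k H →ₐ[k] Module.End k (SymmetricAlgebra k H) :=
  (contractAlg q).val.comp (SymmetricAlgebra.lift (contractMap q))

@[simp]
theorem diffOp_ι (q : LinearMap.BilinForm k H) (x : H) :
    diffOp q (SymmetricAlgebra.ι k H x) = contract q x := by
  simp [diffOp, contractMap]

/-- The pairing on `S^• H` induced by `q`: the constant term of `∂_a b`. Different homogeneous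
components are orthogonal, and on `S^m H` it is
`⟨x₁ ⋯ x_m, y₁ ⋯ y_m⟩ = ∑_σ ∏_i q(x_i, y_{σ i})`. -/
def symPairing (q : LinearMap.BilinForm k H) (a b : SymmetricAlgebra k H) : k :=
  SymmetricAlgebra.algebraMapInv (diffOp q a b)

variable [FiniteDimensional k H]

/-- The element of `S² H` given by `q ∈ H^* ⊗ H^*` under the identification `H^* ≃ H` by `q`. -/
def qElt (q : LinearMap.BilinForm k H) (hq : q.Nondegenerate) : SymmetricAlgebra k H :=
  LinearMap.mul' k (SymmetricAlgebra k H)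
    (TensorProduct.map
      (SymmetricAlgebra.ι k H ∘ₗ (q.toDual hq).symm.toLinearMap)
      (SymmetricAlgebra.ι k H ∘ₗ (q.toDual hq).symm.toLinearMap)
      ((dualTensorHomEquiv k H (Module.Dual k H)).symm q))

/-- `R_{n,r} ⊆ S^{n+r} H`: the orthogonal complement in `S^{n+r} H` of the image of `S^{n-r} H`
under multiplication by `q^r`. Here `S^{n-r} H = 0` if `r > n`, so that
`R_{n,r} = S^{n+r} H` in this case. -/
def R (q : LinearMap.BilinForm k H) (hq : q.Nondegenerate) (n r : ℕ) :
    Set (SymmetricAlgebra k H) :=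
  {f | f ∈ symPart k H (n + r) ∧
    ∀ j : ℕ, j + r = n → ∀ g ∈ symPart k H j, symPairing q f (qElt q hq ^ r * g) = 0}

/-- The ideal of `S^• H` that defines the `n`-th `F`-algebra. -/
def fIdeal (q : LinearMap.BilinForm k H) (hq : q.Nondegenerate) (n : ℕ) :
    Ideal (SymmetricAlgebra k H) :=
  Ideal.span (⋃ r : ℕ, R q hq n r)

/-- The `n`-th `F`-algebra `F_n^•(H)` of `(H, q)`. -/
abbrev FAlgebra (q : LinearMap.BilinForm k H) (hq : q.Nondegenerate) (n : ℕ) : Type _ :=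
  SymmetricAlgebra k H ⧸ fIdeal q hq n

/-- The homogeneous component `F_n^j(H)`: the image of `S^i H` if `j = 2 i`, and `0` if `j` is
odd. -/
def fPart (q : LinearMap.BilinForm k H) (hq : q.Nondegenerate) (n j : ℕ) :
    Submodule k (FAlgebra q hq n) :=
  if Even j then
    (symPart k H (j / 2)).map (Ideal.Quotient.mkₐ k (fIdeal q hq n)).toLinearMap
  else ⊥

/-- The ideal of `S^• H` generated by the powers `x^{n+1}` with `x` isotropic. -/
def isotropicIdeal (q : LinearMap.BilinForm k H) (n : ℕ) : Ideal (SymmetricAlgebra k H) :=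
  Ideal.span {a | ∃ x : H, q x x = 0 ∧ a = SymmetricAlgebra.ι k H x ^ (n + 1)}

end Sym

section Clifford

variable {k : Type*} [Field k] {H : Type*} [AddCommGroup H] [Module k H]

/-- The Clifford algebra `Cl(H, q)`, with `x * x = q(x, x)` for `x : H`. -/
abbrev Cl (q : LinearMap.BilinForm k H) : Type _ :=
  CliffordAlgebra (LinearMap.BilinMap.toQuadraticMap q)

/-- The antiautomorphism `a ↦ ā = α(β(a))` of `Cl(H, q)`. -/
def clBar (q : LinearMap.BilinForm k H) (a : Cl q) : Cl q :=
  CliffordAlgebra.involute (CliffordAlgebra.reverse a)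

variable {V : Type*} [AddCommGroup V] [Module k V]

/-- A bilinear form `b` on a `Cl(H, q)`-module is invariant if `b(a u, v) = b(u, ā v)`. -/
def IsClInvariant (q : LinearMap.BilinForm k H) [Module (Cl q) V]
    (b : LinearMap.BilinForm k V) : Prop :=
  ∀ (a : Cl q) (u v : V), b (a • u) v = b u (clBar q a • v)

/-- The linear map from bilinear forms on `V` to `Λ² V^* ⊆ Λ^• V^*` that sends the form
`(u, v) ↦ f(u) g(v)` to `½ f ∧ g`. On alternating forms it is the usual identification with
`Λ² V^*`, in which `f ∧ g` is the form `(u, v) ↦ f(u) g(v) - f(v) g(u)`. -/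
def formToExt [FiniteDimensional k V] :
    LinearMap.BilinForm k V →ₗ[k] ExteriorAlgebra k (Module.Dual k V) :=
  (2⁻¹ : k) •
    (LinearMap.mul' k (ExteriorAlgebra k (Module.Dual k V)) ∘ₗ
      TensorProduct.map (ExteriorAlgebra.ι k) (ExteriorAlgebra.ι k) ∘ₗ
      (dualTensorHomEquiv k V (Module.Dual k V)).symm.toLinearMap)

variable (q : LinearMap.BilinForm k H) [Module (Cl q) V] [IsScalarTower k (Cl q) V]

/-- The bilinear form `ω_x(u, v) = τ(x u, v)` on `V`, depending linearly on `x : H`. -/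
def omegaForm (τ : LinearMap.BilinForm k V) : H →ₗ[k] LinearMap.BilinForm k V :=
  LinearMap.llcomp k V V (Module.Dual k V) τ ∘ₗ
    (Algebra.lsmul k k V : Cl q →ₐ[k] Module.End k V).toLinearMap ∘ₗ
    CliffordAlgebra.ι (LinearMap.BilinMap.toQuadraticMap q)

@[simp]
theorem omegaForm_apply (τ : LinearMap.BilinForm k V) (x : H) (u v : V) :
    omegaForm q τ x u v =
      τ (CliffordAlgebra.ι (LinearMap.BilinMap.toQuadraticMap q) x • u) v :=
  rfl

/-- The map `φ : H → Λ² V^* ⊆ Λ^• V^*`, `x ↦ ω_x`. -/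
def phi [FiniteDimensional k V] (τ : LinearMap.BilinForm k V) :
    H →ₗ[k] ExteriorAlgebra k (Module.Dual k V) :=
  formToExt ∘ₗ omegaForm q τ

/-- The subalgebra `A^•` of `Λ^• V^*` generated by the image `W` of `φ`. -/
def subalgebraA [FiniteDimensional k V] (τ : LinearMap.BilinForm k V) :
    Subalgebra k (ExteriorAlgebra k (Module.Dual k V)) :=
  Algebra.adjoin k (LinearMap.range (phi q τ) : Set (ExteriorAlgebra k (Module.Dual k V)))

end Clifford

end FAlg

end

/-!
Let `S = S^• H`, let `J` be the kernel of the homomorphism `S → A`, `x ↦ ω_x` (`symToA`), and call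
*generators* of degree `d` the powers `x^d` of isotropic vectors, all vectors being admitted if
`d ≤ 1`. The proof identifies both `J` and the ideal of the `F`-algebra with one explicit subspace:
`fSpan`, the span of all `q^j h` with `h` a generator of degree `d` and `j + d > n`.

* *Harmonic expansion.* If `H ≠ 0`, then `S^m H` is the sum of the spaces `q^j · (generators of
  degree m - 2j)` (`exists_sum_qElt_pow_mul`). For `dim H ≥ 2` this is because the coefficients of
  the powers of the isotropic vectors `x + t v - ½ t² q(v, v) z` are again combinations of powers
  of isotropic vectors; the coefficient of `t²`, summed over an orthonormal basis, gives `q x^N`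
  (`qElt_mul_ι_pow_sub_mem`). The same relation shows by induction on `j` that `fSpan` lies in the
  ideal generated by the powers `x^{n+1}` with `x` isotropic (`fSpan_le_isotropicIdeal`).
  The generators are harmonic, so that `∂_q` maps `q^{j+1} h` to a nonzero multiple of `q^j h`;
  hence the sum is direct (`eq_zero_of_sum_qElt_pow_mul`).
* *The ideal of the `F`-algebra.* For `r ≤ n`, `fSpan` is orthogonal to `q^r S^{n-r} H`, and
  `S^{n+r} H ⊆ fSpan + q^r S^{n-r} H`, where `∂_q^r` is injective on the second summand. So the
  spaces `R_{n,r}` lie in `fSpan` (`R_subset_fSpan`), and every `q^j h` that spans `fSpan` lies in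
  one of them.
* *The kernel contains `fSpan`.* If `x` is isotropic, then `x` acts on `V` with square zero, so that
  `ω_x` has rank at most `2n` and `ω_x^{n+1} = 0` (`phi_pow_eq_zero`). If `dim H = 1`, the elements
  of `fSpan` have degree more than `2n`, and vanish in the exterior algebra of a space of
  dimension `4n`.
* *`fSpan` contains the kernel.* If `q(x, x) ≠ 0`, then `ω_x` is nondegenerate and `ω_x^{2n} ≠ 0`
  (`phi_pow_ne_zero`). As `S^{2n} H` is spanned by `q^n` modulo `fSpan`, it follows that `q^n ∉ J`.
  A homogeneous element of `J` outside `fSpan` yields, modulo `fSpan`, an element `f = q^r g` of `J`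
  with `g ≠ 0` of degree at most `n - r`. Then `∂_f q^n ≠ 0`, so that some multiple of `f` of degree
  `2n` is not orthogonal to `q^n`; it is congruent to a nonzero multiple of `q^n` modulo `fSpan`,
  a contradiction (`eq_zero_of_symToA_qElt_pow_mul`).

The nonvanishing of `ω^{2n}` for a symplectic form `ω` is proved by contraction. If `ω^{s+1} = 0`,
then contracting with `v` gives `ω(v, ·) ∧ ω^s = 0` for all `v`, so that all linear forms annihilate
`ω^s`; by Euler's identity in the exterior algebra, `ω^s` is zero or of top degree.
-/

noncomputable section

namespace FAlg

open Module
open scoped TensorProduct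

/-! ### The grading, the contractions and the pairing on the symmetric algebra -/

section SymBasics

variable {k : Type*} [Field k] {H : Type*} [AddCommGroup H] [Module k H]

theorem exists_orthonormal_basis [CharZero k] [IsAlgClosed k] [FiniteDimensional k H]
    {q : LinearMap.BilinForm k H} (hs : q.IsSymm) (hq : q.Nondegenerate) :
    ∃ e : Basis (Fin (finrank k H)) k H, ∀ i j, q (e i) (e j) = if i = j then 1 else 0 := by
  have : Invertible (2 : k) := invertibleOfNonzero two_ne_zero
  obtain ⟨v, hv⟩ := LinearMap.BilinForm.exists_orthogonal_basis ⟨fun x y => hs.eq x y⟩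
  have hne : ∀ i, q (v i) (v i) ≠ 0 := fun i =>
    LinearMap.BilinForm.iIsOrtho.not_isOrtho_basis_self_of_nondegenerate hv hq i
  choose c hc using fun i => IsAlgClosed.exists_pow_nat_eq (q (v i) (v i)) (n := 2) two_pos
  have hc0 : ∀ i, c i ≠ 0 := fun i h => hne i (by rw [← hc, h]; simp)
  refine ⟨v.unitsSMul fun i => (Units.mk0 (c i) (hc0 i))⁻¹, fun i j => ?_⟩
  simp only [Basis.unitsSMul_apply, Units.smul_def, map_smul, LinearMap.smul_apply, smul_eq_mul,
    Units.val_inv_eq_inv_val, Units.val_mk0]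
  split_ifs with h
  · subst h
    rw [← hc]
    field_simp [hc0 i]
  · have : q (v i) (v j) = 0 := hv h
    simp [this]

theorem symPart_zero : symPart k H 0 = 1 := pow_zero _

theorem ι_mem_symPart (x : H) : SymmetricAlgebra.ι k H x ∈ symPart k H 1 := by
  simp [symPart]

theorem symPart_mul_mem {i j : ℕ} {a b : SymmetricAlgebra k H} (ha : a ∈ symPart k H i)
    (hb : b ∈ symPart k H j) : a * b ∈ symPart k H (i + j) := by
  rw [symPart, pow_add]
  exact Submodule.mul_mem_mul ha hb

theorem symPart_pow_mem {i : ℕ} {a : SymmetricAlgebra k H} (ha : a ∈ symPart k H i) (m : ℕ) :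
    a ^ m ∈ symPart k H (i * m) := by
  rw [symPart, pow_mul]
  exact Submodule.pow_mem_pow _ ha m

theorem ι_pow_mem_symPart (x : H) (m : ℕ) : SymmetricAlgebra.ι k H x ^ m ∈ symPart k H m := by
  simpa using symPart_pow_mem (ι_mem_symPart (k := k) x) m

theorem symPart_succ_le {m : ℕ} {P : Submodule k (SymmetricAlgebra k H)}
    (h : ∀ x, ∀ a ∈ symPart k H m, SymmetricAlgebra.ι k H x * a ∈ P) :
    symPart k H (m + 1) ≤ P := by
  rw [symPart, pow_succ', Submodule.mul_le]
  rintro _ ⟨x, rfl⟩ a ha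
  exact h x a ha

theorem iSup_symPart : ⨆ i, symPart k H i = ⊤ := by
  refine top_unique fun a _ => ?_
  induction a using SymmetricAlgebra.induction with
  | algebraMap r =>
    refine Submodule.mem_iSup_of_mem 0 ?_
    rw [symPart_zero]
    exact Submodule.algebraMap_mem r
  | ι x => exact Submodule.mem_iSup_of_mem 1 (ι_mem_symPart x)
  | add a b ha hb => exact add_mem (ha trivial) (hb trivial)
  | mul a b ha hb =>
    have h := Submodule.mul_mem_mul (ha trivial) (hb trivial)
    rw [Submodule.iSup_mul] at h
    refine (iSup_le fun i => ?_ : _ ≤ ⨆ i, symPart k H i) h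
    rw [Submodule.mul_iSup]
    refine iSup_le fun j => Submodule.mul_le.2 fun x hx y hy => ?_
    exact Submodule.mem_iSup_of_mem (i + j) (symPart_mul_mem hx hy)

theorem contract_algebraMap (q : LinearMap.BilinForm k H) (x : H) (r : k) :
    contract q x (algebraMap k _ r) = 0 :=
  (derivOfForm (q x)).map_algebraMap r

theorem contract_one (q : LinearMap.BilinForm k H) (x : H) : contract q x 1 = 0 := by
  simpa using contract_algebraMap q x 1

theorem contract_pow (q : LinearMap.BilinForm k H) (x : H) (a : SymmetricAlgebra k H) (m : ℕ) :
    contract q x (a ^ (m + 1)) = (m + 1 : k) • (a ^ m * contract q x a) := by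
  have := (derivOfForm (q x)).leibniz_pow a (m + 1)
  refine this.trans ?_
  rw [Nat.add_sub_cancel, ← Nat.cast_smul_eq_nsmul k]
  push_cast
  rfl

theorem contract_symPart_zero (q : LinearMap.BilinForm k H) (x : H) {a : SymmetricAlgebra k H}
    (ha : a ∈ symPart k H 0) : contract q x a = 0 := by
  rw [symPart_zero] at ha
  obtain ⟨r, rfl⟩ := Submodule.mem_one.1 ha
  exact contract_algebraMap q x r

theorem contract_mem_symPart (q : LinearMap.BilinForm k H) (x : H) (m : ℕ) :
    ∀ a ∈ symPart k H (m + 1), contract q x a ∈ symPart k H m := by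
  induction m with
  | zero =>
    refine symPart_succ_le (P := (symPart k H 0).comap (contract q x)) fun y a ha => ?_
    rw [Submodule.mem_comap, contract_mul, contract_symPart_zero q x ha, contract_ι,
      mul_zero, zero_add, mul_comm, ← Algebra.smul_def]
    exact Submodule.smul_mem _ _ ha
  | succ m ih =>
    refine symPart_succ_le (P := (symPart k H (m + 1)).comap (contract q x)) fun y a ha => ?_
    rw [Submodule.mem_comap, contract_mul, contract_ι, mul_comm a, ← Algebra.smul_def]
    refine add_mem ?_ (Submodule.smul_mem _ _ ha)
    rw [add_comm m 1]
    exact symPart_mul_mem (ι_mem_symPart y) (ih a ha)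

theorem diffOp_mem_symPart (q : LinearMap.BilinForm k H) (m d : ℕ) {a b : SymmetricAlgebra k H}
    (ha : a ∈ symPart k H d) (hb : b ∈ symPart k H (m + d)) : diffOp q a b ∈ symPart k H m := by
  induction d generalizing a b with
  | zero =>
    rw [symPart_zero] at ha
    obtain ⟨r, rfl⟩ := Submodule.mem_one.1 ha
    rw [AlgHom.commutes, Module.algebraMap_end_apply]
    exact Submodule.smul_mem _ _ hb
  | succ d ih =>
    refine symPart_succ_le (P := (symPart k H m).comap ((diffOp q).toLinearMap.flip b))
      (fun y c hc => ?_) ha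
    rw [Submodule.mem_comap, LinearMap.flip_apply, AlgHom.toLinearMap_apply, mul_comm, map_mul,
      diffOp_ι]
    exact ih hc (contract_mem_symPart q y (m + d) b hb)

theorem diffOp_mul_apply (q : LinearMap.BilinForm k H) (a b c : SymmetricAlgebra k H) :
    diffOp q (a * b) c = diffOp q a (diffOp q b c) := by
  simp

/-- Operators `∂_b` and multiplication by a vector commute up to the operator `∂_{∂_x b}`. -/
theorem diffOp_ι_mul {q : LinearMap.BilinForm k H} (hs : q.IsSymm) (x : H)
    (b a : SymmetricAlgebra k H) :
    diffOp q b (SymmetricAlgebra.ι k H x * a) =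
      SymmetricAlgebra.ι k H x * diffOp q b a + diffOp q (contract q x b) a := by
  induction b using SymmetricAlgebra.induction generalizing a with
  | algebraMap r => simp [contract_algebraMap, AlgHom.commutes, Module.algebraMap_end_apply]
  | ι y =>
    rw [diffOp_ι, contract_mul, contract_ι, contract_ι, AlgHom.commutes,
      Module.algebraMap_end_apply, hs.eq, mul_comm a, ← Algebra.smul_def]
  | add b c hb hc => simp only [map_add, LinearMap.add_apply, hb, hc, mul_add]; abel
  | mul b c hb hc =>
    rw [contract_mul, diffOp_mul_apply, hc, map_add, hb, map_add, LinearMap.add_apply,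
      diffOp_mul_apply, diffOp_mul_apply, mul_comm c, diffOp_mul_apply]
    abel

theorem symPairing_ι_mul {q : LinearMap.BilinForm k H} (hs : q.IsSymm) (x : H)
    (b a : SymmetricAlgebra k H) :
    symPairing q b (SymmetricAlgebra.ι k H x * a) = symPairing q (contract q x b) a := by
  simp [symPairing, diffOp_ι_mul hs, SymmetricAlgebra.algebraMapInv_ι]

theorem symPairing_mul (q : LinearMap.BilinForm k H)
    (a b c : SymmetricAlgebra k H) :
    symPairing q (a * b) c = symPairing q a (diffOp q b c) := by
  simp [symPairing]

theorem symPairing_add_left (q : LinearMap.BilinForm k H) (a b c : SymmetricAlgebra k H) :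
    symPairing q (a + b) c = symPairing q a c + symPairing q b c := by
  simp [symPairing]

/-- Multiplication by `b` is adjoint to `∂_b`. -/
theorem symPairing_mul_right {q : LinearMap.BilinForm k H} (hs : q.IsSymm)
    (a b c : SymmetricAlgebra k H) :
    symPairing q a (b * c) = symPairing q (diffOp q b a) c := by
  induction b using SymmetricAlgebra.induction generalizing a c with
  | algebraMap r =>
    rw [← Algebra.smul_def, AlgHom.commutes, Module.algebraMap_end_apply]
    simp [symPairing]
  | ι y => rw [symPairing_ι_mul hs, diffOp_ι]
  | add b d hb hd =>
    have h := hb a c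
    have h' := hd a c
    simp only [symPairing, add_mul, map_add, LinearMap.add_apply] at h h' ⊢
    rw [h, h']
  | mul b d hb hd => rw [mul_assoc, hb, hd, mul_comm b d, diffOp_mul_apply]

theorem symPairing_one_right (q : LinearMap.BilinForm k H) (a : SymmetricAlgebra k H) :
    symPairing q a 1 = SymmetricAlgebra.algebraMapInv a := by
  have key : diffOp q a 1 = algebraMap k _ (SymmetricAlgebra.algebraMapInv a) := by
    induction a using SymmetricAlgebra.induction with
    | algebraMap r => simp [AlgHom.commutes, Module.algebraMap_end_apply, Algebra.smul_def]
    | ι y => simp [contract_one, SymmetricAlgebra.algebraMapInv_ι]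
    | add b c hb hc => simp [hb, hc]
    | mul b c hb hc =>
      rw [_root_.map_mul, Module.End.mul_apply, hc, Algebra.algebraMap_eq_smul_one, map_smul, hb,
        _root_.map_mul, mul_comm, _root_.map_mul, Algebra.smul_def]
  rw [symPairing, key]
  simp

theorem symPairing_comm {q : LinearMap.BilinForm k H} (hs : q.IsSymm)
    (a b : SymmetricAlgebra k H) : symPairing q a b = symPairing q b a := by
  rw [← mul_one b, symPairing_mul_right hs, symPairing_one_right, mul_one, symPairing]

end SymBasics

/-! ### Euler's identity and the Laplace operator -/

section Laplace

variable {k : Type*} [Field k] {H : Type*} [AddCommGroup H] [Module k H]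
variable {ι : Type*} [Fintype ι] [DecidableEq ι] {q : LinearMap.BilinForm k H}
variable {e : Basis ι k H}

theorem sum_smul_orthonormal (he : ∀ i j, q (e i) (e j) = if i = j then 1 else 0) (x : H) :
    ∑ i, q (e i) x • e i = x := by
  have h : ∀ i, q (e i) x = e.repr x i := fun i => by
    conv_lhs => rw [← e.sum_repr x]
    simp only [map_sum, map_smul, he, smul_eq_mul]
    simp
  simp only [h, e.sum_repr]

theorem qElt_eq_sum [FiniteDimensional k H] (hq : q.Nondegenerate)
    (he : ∀ i j, q (e i) (e j) = if i = j then 1 else 0) :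
    qElt q hq = ∑ i, SymmetricAlgebra.ι k H (e i) ^ 2 := by
  have h1 : (dualTensorHomEquiv k H (Dual k H)).symm q = ∑ i, q (e i) ⊗ₜ[k] q (e i) := by
    rw [LinearEquiv.symm_apply_eq]
    ext x y
    simp only [map_sum, LinearMap.sum_apply, dualTensorHomEquiv]
    conv_lhs => rw [← sum_smul_orthonormal he x]
    simp
  have h2 : ∀ i, (q.toDual hq).symm (q (e i)) = e i := fun i => by
    rw [LinearEquiv.symm_apply_eq]
    ext y
    rw [LinearMap.BilinForm.toDual_def]
  rw [qElt, h1]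
  simp [h2, pow_two]

theorem qElt_mem_symPart [FiniteDimensional k H] (hq : q.Nondegenerate)
    (he : ∀ i j, q (e i) (e j) = if i = j then 1 else 0) :
    qElt q hq ∈ symPart k H 2 := by
  rw [qElt_eq_sum hq he]
  exact Submodule.sum_mem _ fun i _ => ι_pow_mem_symPart _ _

/-- Euler's identity. -/
theorem sum_ι_mul_contract
    (he : ∀ i j, q (e i) (e j) = if i = j then 1 else 0) (m : ℕ) :
    ∀ a ∈ symPart k H m, ∑ i, SymmetricAlgebra.ι k H (e i) * contract q (e i) a = (m : k) • a := by
  induction m with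
  | zero => intro a ha; simp [contract_symPart_zero q _ ha]
  | succ m ih =>
    let E : End k (SymmetricAlgebra k H) :=
      ∑ i, LinearMap.mulLeft k (SymmetricAlgebra.ι k H (e i)) ∘ₗ contract q (e i)
    have hE : ∀ a, E a = ∑ i, SymmetricAlgebra.ι k H (e i) * contract q (e i) a := fun a => by
      simp [E, LinearMap.sum_apply]
    have key : symPart k H (m + 1) ≤
        LinearMap.ker (E - ((m + 1 : ℕ) : k) • (LinearMap.id : End k (SymmetricAlgebra k H))) := by
      refine symPart_succ_le fun x b hb => ?_
      simp only [LinearMap.mem_ker, LinearMap.sub_apply, LinearMap.smul_apply, LinearMap.id_apply,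
        hE, contract_mul, contract_ι, mul_add, Finset.sum_add_distrib]
      have h1 : ∑ i, SymmetricAlgebra.ι k H (e i) *
          (SymmetricAlgebra.ι k H x * contract q (e i) b) =
          (m : k) • (SymmetricAlgebra.ι k H x * b) := by
        rw [← mul_smul_comm, ← ih b hb, Finset.mul_sum]
        exact Finset.sum_congr rfl fun i _ => by ring
      have h2 : ∑ i, SymmetricAlgebra.ι k H (e i) * (b * algebraMap k _ (q (e i) x)) =
          SymmetricAlgebra.ι k H x * b := by
        conv_rhs => rw [← sum_smul_orthonormal he x]
        rw [map_sum, Finset.sum_mul]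
        exact Finset.sum_congr rfl fun i _ => by rw [map_smul, Algebra.smul_def]; ring
      rw [h1, h2]
      push_cast
      rw [add_smul, one_smul, sub_self]
    intro a ha
    have h := key ha
    rwa [LinearMap.mem_ker, LinearMap.sub_apply, LinearMap.smul_apply, LinearMap.id_apply, hE,
      sub_eq_zero] at h

theorem symPairing_nondegenerate [CharZero k] (hs : q.IsSymm)
    (he : ∀ i j, q (e i) (e j) = if i = j then 1 else 0) (m : ℕ) :
    ∀ a ∈ symPart k H m, (∀ b ∈ symPart k H m, symPairing q b a = 0) → a = 0 := by
  induction m with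
  | zero =>
    intro a ha h
    have h1 := h 1 (by rw [symPart_zero]; exact Submodule.one_le.1 le_rfl)
    rw [symPart_zero] at ha
    obtain ⟨r, rfl⟩ := Submodule.mem_one.1 ha
    rw [symPairing_comm hs, symPairing_one_right] at h1
    simp at h1
    simp [h1]
  | succ m ih =>
    intro a ha h
    have h1 : ∀ i, contract q (e i) a = 0 := fun i => by
      refine ih _ (contract_mem_symPart q _ m a ha) fun b hb => ?_
      rw [← diffOp_ι, ← symPairing_mul]
      exact h _ (symPart_mul_mem hb (ι_mem_symPart _))
    have h2 := sum_ι_mul_contract he (m + 1) a ha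
    simp only [h1, mul_zero, Finset.sum_const_zero] at h2
    have : ((m + 1 : ℕ) : k) ≠ 0 := Nat.cast_ne_zero.2 m.succ_ne_zero
    exact (smul_eq_zero.1 h2.symm).resolve_left this

theorem diffOp_qElt_apply [FiniteDimensional k H] (hq : q.Nondegenerate)
    (he : ∀ i j, q (e i) (e j) = if i = j then 1 else 0) (a : SymmetricAlgebra k H) :
    diffOp q (qElt q hq) a = ∑ i, contract q (e i) (contract q (e i) a) := by
  rw [qElt_eq_sum hq he]
  simp [pow_two]

theorem contract_qElt [FiniteDimensional k H] (hs : q.IsSymm) (hq : q.Nondegenerate)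
    (he : ∀ i j, q (e i) (e j) = if i = j then 1 else 0) (x : H) :
    contract q x (qElt q hq) = (2 : k) • SymmetricAlgebra.ι k H x := by
  rw [qElt_eq_sum hq he, map_sum]
  conv_rhs => rw [← sum_smul_orthonormal he x]
  rw [map_sum, Finset.smul_sum]
  refine Finset.sum_congr rfl fun i _ => ?_
  rw [contract_pow, contract_ι, map_smul, pow_one, hs.eq, mul_comm, ← Algebra.smul_def]
  norm_num

/-- The commutator of the Laplace operator `∂_q` with multiplication by `q`, on `S^d H`. -/
theorem diffOp_qElt_qElt_mul [FiniteDimensional k H] (hs : q.IsSymm) (hq : q.Nondegenerate)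
    (he : ∀ i j, q (e i) (e j) = if i = j then 1 else 0) {d : ℕ} {a : SymmetricAlgebra k H}
    (ha : a ∈ symPart k H d) :
    diffOp q (qElt q hq) (qElt q hq * a) =
      qElt q hq * diffOp q (qElt q hq) a + ((4 * d + 2 * Fintype.card ι : ℕ) : k) • a := by
  rw [diffOp_qElt_apply hq he, diffOp_qElt_apply hq he, Finset.mul_sum]
  have h : ∀ i, contract q (e i) (contract q (e i) (qElt q hq * a)) =
      qElt q hq * contract q (e i) (contract q (e i) a) +
        (4 : k) • (SymmetricAlgebra.ι k H (e i) * contract q (e i) a) + (2 : k) • a := fun i => by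
    simp only [contract_mul, contract_qElt hs hq he, map_add, map_smul, contract_ι, he,
      if_pos, map_one]
    simp only [Algebra.smul_def, map_ofNat]
    ring
  simp only [h, Finset.sum_add_distrib, ← Finset.smul_sum, sum_ι_mul_contract he d a ha]
  simp only [Finset.sum_const, Finset.card_univ, ← Nat.cast_smul_eq_nsmul k, smul_smul, add_assoc,
    ← add_smul]
  push_cast
  congr 2

end Laplace

/-! ### Expansion in powers of `q` and harmonic generators -/

section Generators

variable {k : Type*} [Field k] {H : Type*} [AddCommGroup H] [Module k H]

/-- The span of the powers `x^d` with `x` isotropic; for `d ≤ 1` all vectors `x` are admitted, so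
that it also gives the harmonic polynomials of degree `d` if `dim H = 1`. -/
def genPart (q : LinearMap.BilinForm k H) (d : ℕ) : Submodule k (SymmetricAlgebra k H) :=
  Submodule.span k {a | ∃ x : H, (q x x = 0 ∨ d ≤ 1) ∧ a = SymmetricAlgebra.ι k H x ^ d}

theorem genPart_le_symPart (q : LinearMap.BilinForm k H) (d : ℕ) :
    genPart q d ≤ symPart k H d := by
  refine Submodule.span_le.2 ?_
  rintro _ ⟨x, -, rfl⟩
  exact ι_pow_mem_symPart x d

theorem symPart_zero_le_genPart (q : LinearMap.BilinForm k H) :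
    symPart k H 0 ≤ genPart q 0 := by
  rw [symPart_zero, Submodule.one_le]
  exact Submodule.subset_span ⟨0, by simp⟩

theorem symPart_one_le_genPart (q : LinearMap.BilinForm k H) :
    symPart k H 1 ≤ genPart q 1 := by
  rw [symPart, pow_one]
  rintro _ ⟨x, rfl⟩
  exact Submodule.subset_span ⟨x, by simp⟩

theorem contract_ι_pow_of_isotropic {q : LinearMap.BilinForm k H} {x : H} (hx : q x x = 0)
    (m : ℕ) : contract q x (SymmetricAlgebra.ι k H x ^ m) = 0 := by
  cases m with
  | zero => simp [contract_one]
  | succ m => simp [contract_pow, hx]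

theorem symPairing_eq_zero_of_lt (q : LinearMap.BilinForm k H) {i j : ℕ} (hij : i < j)
    {a b : SymmetricAlgebra k H} (ha : a ∈ symPart k H i) (hb : b ∈ symPart k H j) :
    symPairing q a b = 0 := by
  obtain ⟨m, rfl⟩ := Nat.exists_eq_add_of_lt hij
  have h1 : diffOp q a b ∈ symPart k H (m + 1) :=
    diffOp_mem_symPart q (m + 1) i ha (by rwa [show m + 1 + i = i + m + 1 by ring])
  refine (symPart_succ_le (P := LinearMap.ker (SymmetricAlgebra.algebraMapInv
    (R := k) (M := H)).toLinearMap) fun x c _ => ?_) h1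
  simp [SymmetricAlgebra.algebraMapInv_ι]

variable {ι : Type*} [Fintype ι] [DecidableEq ι] {q : LinearMap.BilinForm k H}
variable {e : Basis ι k H} [FiniteDimensional k H]

/-- The generators are harmonic. -/
theorem diffOp_qElt_genPart (hs : q.IsSymm) (hq : q.Nondegenerate)
    (he : ∀ i j, q (e i) (e j) = if i = j then 1 else 0) {d : ℕ} {p : SymmetricAlgebra k H}
    (hp : p ∈ genPart q d) : diffOp q (qElt q hq) p = 0 := by
  have h1 : diffOp q (qElt q hq) 1 = 0 := by simp [diffOp_qElt_apply hq he, contract_one]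
  have h : ∀ (x : H) a, diffOp q (qElt q hq) (SymmetricAlgebra.ι k H x * a) =
      SymmetricAlgebra.ι k H x * diffOp q (qElt q hq) a + (2 : k) • contract q x a := fun x a => by
    rw [diffOp_ι_mul hs, contract_qElt hs hq he, map_smul, diffOp_ι, LinearMap.smul_apply]
  refine (Submodule.span_le (p := LinearMap.ker (diffOp q (qElt q hq)))).2 ?_ hp
  rintro _ ⟨x, hx | hd, rfl⟩
  · rw [SetLike.mem_coe, LinearMap.mem_ker]
    clear hp
    induction d with
    | zero => rw [pow_zero, h1]
    | succ d ih =>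
      rw [pow_succ', h, contract_ι_pow_of_isotropic hx, ih]
      simp
  · rw [SetLike.mem_coe, LinearMap.mem_ker]
    interval_cases d
    · rw [pow_zero, h1]
    · rw [pow_one, ← mul_one (SymmetricAlgebra.ι k H x), h, h1, contract_one]
      simp

theorem qElt_pow_mul_mem (hq : q.Nondegenerate)
    (he : ∀ i j, q (e i) (e j) = if i = j then 1 else 0) {d : ℕ} {p : SymmetricAlgebra k H}
    (hp : p ∈ symPart k H d) (j : ℕ) : qElt q hq ^ j * p ∈ symPart k H (2 * j + d) :=
  symPart_mul_mem (symPart_pow_mem (qElt_mem_symPart hq he) j) hp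

theorem diffOp_qElt_qElt_pow_mul (hs : q.IsSymm) (hq : q.Nondegenerate)
    (he : ∀ i j, q (e i) (e j) = if i = j then 1 else 0) {d : ℕ} {p : SymmetricAlgebra k H}
    (hp : p ∈ genPart q d) (j : ℕ) :
    diffOp q (qElt q hq) (qElt q hq ^ (j + 1) * p) =
      (((j + 1) * (4 * j + 4 * d + 2 * Fintype.card ι) : ℕ) : k) • (qElt q hq ^ j * p) := by
  induction j with
  | zero =>
    rw [zero_add, pow_one, diffOp_qElt_qElt_mul hs hq he (genPart_le_symPart q d hp),
      diffOp_qElt_genPart hs hq he hp]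
    simp
  | succ j ih =>
    rw [pow_succ', mul_assoc, diffOp_qElt_qElt_mul hs hq he
      (qElt_pow_mul_mem hq he (genPart_le_symPart q d hp) _), ih, mul_smul_comm, ← mul_assoc,
      ← pow_succ', ← add_smul]
    congr 1
    push_cast
    ring

theorem exists_diffOp_qElt_pow_mul [CharZero k] (hs : q.IsSymm) (hq : q.Nondegenerate)
    (he : ∀ i j, q (e i) (e j) = if i = j then 1 else 0) (hD : 0 < Fintype.card ι)
    (d i s : ℕ) : ∃ c : k, c ≠ 0 ∧ ∀ p ∈ genPart q d,
      diffOp q (qElt q hq ^ s) (qElt q hq ^ (i + s) * p) = c • (qElt q hq ^ i * p) := by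
  induction s with
  | zero => exact ⟨1, one_ne_zero, fun p _ => by simp⟩
  | succ s ih =>
    obtain ⟨c, hc, h⟩ := ih
    refine ⟨(((i + s + 1) * (4 * (i + s) + 4 * d + 2 * Fintype.card ι) : ℕ) : k) * c,
      mul_ne_zero (Nat.cast_ne_zero.2 (by positivity)) hc, fun p hp => ?_⟩
    rw [pow_succ, diffOp_mul_apply, ← add_assoc, diffOp_qElt_qElt_pow_mul hs hq he hp, map_smul,
      h p hp, smul_smul]

theorem diffOp_qElt_pow_mul_eq_zero (hs : q.IsSymm) (hq : q.Nondegenerate)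
    (he : ∀ i j, q (e i) (e j) = if i = j then 1 else 0)
    {d : ℕ} {p : SymmetricAlgebra k H} (hp : p ∈ genPart q d) {i s : ℕ} (his : i < s) :
    diffOp q (qElt q hq ^ s) (qElt q hq ^ i * p) = 0 := by
  induction i generalizing s with
  | zero =>
    obtain ⟨s, rfl⟩ := Nat.exists_eq_add_of_lt his
    rw [pow_zero, one_mul, pow_succ, diffOp_mul_apply, diffOp_qElt_genPart hs hq he hp, map_zero]
  | succ i ih =>
    obtain ⟨s, rfl⟩ : ∃ t, s = t + 1 := ⟨s - 1, by omega⟩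
    rw [pow_succ, diffOp_mul_apply, diffOp_qElt_qElt_pow_mul hs hq he hp, map_smul,
      ih (by omega), smul_zero]

/-- The sum of the spaces `q^j genPart d` over `j` is direct. -/
theorem eq_zero_of_sum_qElt_pow_mul [CharZero k] (hs : q.IsSymm) (hq : q.Nondegenerate)
    (he : ∀ i j, q (e i) (e j) = if i = j then 1 else 0) (hD : 0 < Fintype.card ι)
    (d : ℕ → ℕ) (p : ℕ → SymmetricAlgebra k H) (a N : ℕ) (hp : ∀ j < N, p j ∈ genPart q (d j))
    (h : ∑ j ∈ Finset.range N, qElt q hq ^ (a + j) * p j = 0) : ∀ j < N, p j = 0 := by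
  induction N with
  | zero => intro j hj; omega
  | succ N ih =>
    have hN : p N = 0 := by
      -- the power `∂_q^(a + N)` kills all summands but the last
      have h1 := congrArg (diffOp q (qElt q hq ^ (a + N))) h
      rw [map_zero, map_sum, Finset.sum_range_succ, Finset.sum_eq_zero, zero_add] at h1
      · obtain ⟨c, hc, hc'⟩ := exists_diffOp_qElt_pow_mul hs hq he hD (d N) 0 (a + N)
        have h2 := hc' (p N) (hp N (by omega))
        rw [zero_add, h1, pow_zero, one_mul] at h2
        exact (smul_eq_zero.1 h2.symm).resolve_left hc
      · intro j hj
        rw [Finset.mem_range] at hj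
        exact diffOp_qElt_pow_mul_eq_zero hs hq he (hp j (by omega)) (by omega)
    intro j hj
    rcases Nat.lt_succ_iff_lt_or_eq.1 hj with hj | rfl
    · refine ih (fun j hj => hp j (by omega)) ?_ j hj
      simpa [Finset.sum_range_succ, hN] using h
    · exact hN

/-- If `x` is isotropic, then `∂_x` kills `x`, so that all factors `∂_x` of `∂_(x^d)` act on a power
of `q`. -/
theorem exists_diffOp_genPart_qElt_pow [CharZero k] (hs : q.IsSymm) (hq : q.Nondegenerate)
    (he : ∀ i j, q (e i) (e j) = if i = j then 1 else 0) (d N : ℕ) :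
    ∃ c : k, c ≠ 0 ∧ ∀ p ∈ genPart q d,
      diffOp q p (qElt q hq ^ (N + d)) = c • (qElt q hq ^ N * p) := by
  have hc : ∀ (x : H) (M : ℕ), contract q x (qElt q hq ^ (M + 1)) =
      (2 * (M + 1) : k) • (SymmetricAlgebra.ι k H x * qElt q hq ^ M) := fun x M => by
    rw [contract_pow, contract_qElt hs hq he, mul_smul_comm, smul_smul, mul_comm (2 : k),
      mul_comm (qElt q hq ^ M)]
  suffices h : ∃ c : k, c ≠ 0 ∧ ∀ x : H, (q x x = 0 ∨ d ≤ 1) →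
      diffOp q (SymmetricAlgebra.ι k H x ^ d) (qElt q hq ^ (N + d)) =
        c • (qElt q hq ^ N * SymmetricAlgebra.ι k H x ^ d) by
    obtain ⟨c, hc0, h⟩ := h
    refine ⟨c, hc0, fun p hp => ?_⟩
    induction hp using Submodule.span_induction with
    | mem p hp => obtain ⟨x, hx, rfl⟩ := hp; exact h x hx
    | zero => simp
    | add a b _ _ ha hb => rw [map_add, LinearMap.add_apply, ha, hb, mul_add, smul_add]
    | smul r a _ ha =>
      rw [map_smul, LinearMap.smul_apply, ha, mul_smul_comm, smul_comm]
  have h2 : ∀ M : ℕ, (2 * (M + 1) : k) ≠ 0 := fun M =>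
    mul_ne_zero two_ne_zero (Nat.cast_add_one_ne_zero M)
  rcases le_or_gt d 1 with hd | hd
  · interval_cases d
    · exact ⟨1, one_ne_zero, fun x _ => by simp⟩
    · exact ⟨2 * (N + 1), h2 N, fun x _ => by
        rw [pow_one, diffOp_ι, hc, mul_comm (qElt q hq ^ N)]⟩
  · suffices h : ∀ d N : ℕ, ∃ c : k, c ≠ 0 ∧ ∀ x : H, q x x = 0 →
        diffOp q (SymmetricAlgebra.ι k H x ^ d) (qElt q hq ^ (N + d)) =
          c • (qElt q hq ^ N * SymmetricAlgebra.ι k H x ^ d) by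
      obtain ⟨c, hc0, h⟩ := h d N
      exact ⟨c, hc0, fun x hx => h x (hx.resolve_right (by omega))⟩
    intro d N
    induction d generalizing N with
    | zero => exact ⟨1, one_ne_zero, fun x _ => by simp⟩
    | succ d ih =>
      obtain ⟨c, hc0, h⟩ := ih (N + 1)
      refine ⟨c * (2 * (N + 1)), mul_ne_zero hc0 (h2 N), fun x hx => ?_⟩
      rw [pow_succ', diffOp_mul_apply, diffOp_ι, show N + (d + 1) = N + 1 + d by ring, h x hx,
        map_smul, contract_mul, contract_ι_pow_of_isotropic hx, mul_zero, zero_add, hc,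
        mul_smul_comm, smul_smul]
      congr 1
      ring

theorem exists_diffOp_qElt_pow_mul_qElt_pow [CharZero k] (hs : q.IsSymm) (hq : q.Nondegenerate)
    (he : ∀ i j, q (e i) (e j) = if i = j then 1 else 0) (hD : 0 < Fintype.card ι) (d j N : ℕ) :
    ∃ c : k, c ≠ 0 ∧ ∀ p ∈ genPart q d,
      diffOp q (qElt q hq ^ j * p) (qElt q hq ^ (N + d + j)) = c • (qElt q hq ^ N * p) := by
  obtain ⟨c, hc, h⟩ := exists_diffOp_qElt_pow_mul hs hq he hD 0 (N + d) j
  obtain ⟨c', hc', h'⟩ := exists_diffOp_genPart_qElt_pow hs hq he d N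
  refine ⟨c * c', mul_ne_zero hc hc', fun p hp => ?_⟩
  have h1 := h 1 (symPart_zero_le_genPart q (by
    rw [symPart_zero]; exact Submodule.one_le.1 le_rfl))
  rw [mul_one, mul_one] at h1
  rw [mul_comm, diffOp_mul_apply, h1, map_smul, h' p hp, smul_smul]

/-- The expansion of a homogeneous polynomial in the generators and the powers of `q`. -/
theorem exists_sum_qElt_pow_mul (hq : q.Nondegenerate)
    (hdec : ∀ m, symPart k H (m + 2) ≤
      genPart q (m + 2) ⊔ (symPart k H m).map (LinearMap.mulLeft k (qElt q hq))) (m : ℕ) :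
    ∀ f ∈ symPart k H m, ∃ p : ℕ → SymmetricAlgebra k H,
      (∀ j < m / 2 + 1, p j ∈ genPart q (m - 2 * j)) ∧
        f = ∑ j ∈ Finset.range (m / 2 + 1), qElt q hq ^ j * p j := by
  induction m using Nat.twoStepInduction with
  | zero =>
    exact fun f hf => ⟨fun _ => f, fun j hj => by
      obtain rfl : j = 0 := by omega
      exact symPart_zero_le_genPart q hf, by simp⟩
  | one =>
    exact fun f hf => ⟨fun _ => f, fun j hj => by
      obtain rfl : j = 0 := by omega
      exact symPart_one_le_genPart q hf, by simp⟩
  | more m ih _ =>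
    intro f hf
    obtain ⟨p₀, hp₀, g, hg, rfl⟩ := Submodule.mem_sup.1 (hdec m hf)
    obtain ⟨f', hf', rfl⟩ := Submodule.mem_map.1 hg
    obtain ⟨p, hp, rfl⟩ := ih f' hf'
    refine ⟨fun j => Nat.rec p₀ (fun i _ => p i) j, fun j hj => ?_, ?_⟩
    · cases j with
      | zero => exact hp₀
      | succ j =>
        have := hp j (by omega)
        rwa [show m + 2 - 2 * (j + 1) = m - 2 * j by omega]
    · rw [show (m + 2) / 2 + 1 = m / 2 + 1 + 1 by omega, Finset.sum_range_succ' _ (m / 2 + 1),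
        add_comm, LinearMap.mulLeft_apply, Finset.mul_sum]
      simp only [pow_succ', mul_assoc, pow_zero, one_mul]
      rfl

/-- The span of all `q^j x^d` with `j + d > n`, where `x^d` is one of the generators. This turns
out to be the ideal that defines the `n`-th `F`-algebra. -/
def fSpan (q : LinearMap.BilinForm k H) (hq : q.Nondegenerate) (n : ℕ) :
    Submodule k (SymmetricAlgebra k H) :=
  Submodule.span k {a | ∃ j d, n < j + d ∧ ∃ p ∈ genPart q d, a = qElt q hq ^ j * p}

theorem mem_fSpan_of_lt (hq : q.Nondegenerate)
    (hdec : ∀ m, symPart k H (m + 2) ≤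
      genPart q (m + 2) ⊔ (symPart k H m).map (LinearMap.mulLeft k (qElt q hq)))
    {n m : ℕ} (hm : 2 * n < m) {f : SymmetricAlgebra k H} (hf : f ∈ symPart k H m) :
    f ∈ fSpan q hq n := by
  obtain ⟨p, hp, rfl⟩ := exists_sum_qElt_pow_mul hq hdec m f hf
  refine Submodule.sum_mem _ fun j hj => Submodule.subset_span ?_
  rw [Finset.mem_range] at hj
  exact ⟨j, m - 2 * j, by omega, p j, hp j hj, rfl⟩

/-- `S^{t+2r} H ⊆ fSpan q hq (t + r) + q^r S^t H`: a term `q^j h` of the expansion with `j < r` has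
`h` of degree `t + 2r - 2j`, and `j + (t + 2r - 2j) > t + r`. -/
theorem exists_eq_add_qElt_pow_mul (hq : q.Nondegenerate)
    (he : ∀ i j, q (e i) (e j) = if i = j then 1 else 0)
    (hdec : ∀ m, symPart k H (m + 2) ≤
      genPart q (m + 2) ⊔ (symPart k H m).map (LinearMap.mulLeft k (qElt q hq)))
    {t r : ℕ} {f : SymmetricAlgebra k H} (hf : f ∈ symPart k H (t + 2 * r)) :
    ∃ l ∈ fSpan q hq (t + r), ∃ g ∈ symPart k H t, f = l + qElt q hq ^ r * g := by
  obtain ⟨p, hp, rfl⟩ := exists_sum_qElt_pow_mul hq hdec _ f hf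
  rw [show (t + 2 * r) / 2 + 1 = r + (t / 2 + 1) by omega, Finset.sum_range_add]
  refine ⟨∑ j ∈ Finset.range r, qElt q hq ^ j * p j,
    Submodule.sum_mem _ fun j hj => Submodule.subset_span ?_,
    ∑ i ∈ Finset.range (t / 2 + 1), qElt q hq ^ i * p (r + i),
    Submodule.sum_mem _ fun i hi => ?_, ?_⟩
  · rw [Finset.mem_range] at hj
    exact ⟨j, t + 2 * r - 2 * j, by omega, p j, hp j (by omega), rfl⟩
  · rw [Finset.mem_range] at hi
    have h1 := qElt_pow_mul_mem hq he (genPart_le_symPart q _ (hp (r + i) (by omega))) i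
    rwa [show 2 * i + (t + 2 * r - 2 * (r + i)) = t by omega] at h1
  · rw [Finset.mul_sum]
    simp only [pow_add, mul_assoc]

/-- `∂_(q^r g)` does not kill `q^n` if `g` is a nonzero polynomial of degree at most `n - r`. -/
theorem eq_zero_of_diffOp_qElt_pow [CharZero k] (hs : q.IsSymm) (hq : q.Nondegenerate)
    (he : ∀ i j, q (e i) (e j) = if i = j then 1 else 0) (hD : 0 < Fintype.card ι)
    (hdec : ∀ m, symPart k H (m + 2) ≤
      genPart q (m + 2) ⊔ (symPart k H m).map (LinearMap.mulLeft k (qElt q hq)))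
    {t r n : ℕ} (hn : t + r ≤ n) {g : SymmetricAlgebra k H} (hg : g ∈ symPart k H t)
    (h : diffOp q (qElt q hq ^ r * g) (qElt q hq ^ n) = 0) : g = 0 := by
  obtain ⟨p, hp, rfl⟩ := exists_sum_qElt_pow_mul hq hdec _ g hg
  obtain ⟨a, rfl⟩ := Nat.exists_eq_add_of_le' hn
  choose c hc0 hc using fun i => exists_diffOp_qElt_pow_mul_qElt_pow hs hq he hD
    (t - 2 * i) (r + i) (a + i)
  have h1 : ∀ i < t / 2 + 1, c i • p i = 0 := by
    refine eq_zero_of_sum_qElt_pow_mul hs hq he hD (fun i => t - 2 * i) _ a (t / 2 + 1)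
      (fun i hi => Submodule.smul_mem _ _ (hp i hi)) ?_
    rw [Finset.mul_sum, map_sum, LinearMap.sum_apply] at h
    rw [← h]
    refine Finset.sum_congr rfl fun i hi => ?_
    rw [Finset.mem_range] at hi
    rw [← mul_assoc, ← pow_add, mul_smul_comm, ← hc i (p i) (hp i hi),
      show a + i + (t - 2 * i) + (r + i) = a + (t + r) by omega]
  refine Finset.sum_eq_zero fun i hi => ?_
  rw [(smul_eq_zero.1 (h1 i (Finset.mem_range.1 hi))).resolve_left (hc0 i), mul_zero]

/-- `fSpan q hq n` is orthogonal to `q^r S^{n-r} H`. -/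
theorem symPairing_fSpan (hs : q.IsSymm) (hq : q.Nondegenerate)
    (he : ∀ i j, q (e i) (e j) = if i = j then 1 else 0) {t r : ℕ} {l h : SymmetricAlgebra k H}
    [CharZero k] (hD : 0 < Fintype.card ι)
    (hl : l ∈ fSpan q hq (t + r)) (hh : h ∈ symPart k H t) :
    symPairing q l (qElt q hq ^ r * h) = 0 := by
  rw [symPairing_comm hs]
  let F : SymmetricAlgebra k H →ₗ[k] k := (SymmetricAlgebra.algebraMapInv
    (R := k) (M := H)).toLinearMap ∘ₗ diffOp q (qElt q hq ^ r * h)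
  refine (Submodule.span_le (p := LinearMap.ker F)).2 ?_ hl
  rintro _ ⟨j, d, hjd, p, hp, rfl⟩
  change symPairing q _ _ = 0
  rw [mul_comm _ h, symPairing_mul]
  rcases lt_or_ge j r with hj | hj
  · rw [diffOp_qElt_pow_mul_eq_zero hs hq he hp hj]
    simp [symPairing]
  · obtain ⟨i, rfl⟩ := Nat.exists_eq_add_of_le' hj
    obtain ⟨c, -, hc⟩ := exists_diffOp_qElt_pow_mul hs hq he hD d i r
    rw [hc p hp]
    exact symPairing_eq_zero_of_lt q (by omega : t < 2 * i + d) hh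
      (Submodule.smul_mem _ _ (qElt_pow_mul_mem hq he (genPart_le_symPart q d hp) i))

end Generators

/-! ### Powers of isotropic vectors -/

section Isotropic

/-- The values of a polynomial at the scalars determine its coefficients, up to any submodule. -/
theorem coeff_mem_of_eval_mem {k S : Type*} [Field k] [Infinite k] [CommRing S] [Algebra k S]
    (P : Submodule k S) (p : Polynomial S) (h : ∀ t : k, p.eval (algebraMap k S t) ∈ P) (i : ℕ) :
    p.coeff i ∈ P := by
  by_contra hi
  obtain ⟨f, hf, hP⟩ := Submodule.exists_le_ker_of_notMem hi
  let g : Polynomial k :=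
    ∑ j ∈ Finset.range (p.natDegree + 1), Polynomial.monomial j (f (p.coeff j))
  have hg : g = 0 := by
    refine Polynomial.funext fun t => ?_
    have h1 : f (p.eval (algebraMap k S t)) = 0 := hP (h t)
    rw [Polynomial.eval_eq_sum_range, map_sum] at h1
    rw [Polynomial.eval_zero, ← h1, Polynomial.eval_finsetSum]
    refine Finset.sum_congr rfl fun j _ => ?_
    rw [Polynomial.eval_monomial, ← map_pow, mul_comm (p.coeff j), ← Algebra.smul_def, map_smul,
      smul_eq_mul, mul_comm]
  refine hf ?_
  have h2 : g.coeff i = f (p.coeff i) := by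
    simp only [g, Polynomial.finsetSum_coeff, Polynomial.coeff_monomial, Finset.sum_ite_eq',
      Finset.mem_range]
    split_ifs with hi'
    · rfl
    · rw [Polynomial.coeff_eq_zero_of_natDegree_lt (by omega), map_zero]
  rw [← h2, hg, Polynomial.coeff_zero]

theorem exists_quadratic_pow_eq {R : Type*} [CommRing R] (a b c : R) (N : ℕ) :
    ∃ r : Polynomial R,
      (Polynomial.C a + Polynomial.C b * Polynomial.X + Polynomial.C c * Polynomial.X ^ 2) ^
          (N + 2) =
        Polynomial.C (a ^ (N + 2)) + Polynomial.C ((N + 2) * (a ^ (N + 1) * b)) * Polynomial.X +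
          Polynomial.C ((N + 2).choose 2 * (a ^ N * b ^ 2) + (N + 2) * (a ^ (N + 1) * c)) *
            Polynomial.X ^ 2 + Polynomial.X ^ 3 * r := by
  induction N with
  | zero =>
    refine ⟨Polynomial.C (2 * (b * c)) + Polynomial.C (c ^ 2) * Polynomial.X, ?_⟩
    simp [map_ofNat]
    ring
  | succ N ih =>
    obtain ⟨r, hr⟩ := ih
    refine ⟨r * (Polynomial.C a + Polynomial.C b * Polynomial.X +
        Polynomial.C c * Polynomial.X ^ 2) + Polynomial.C ((N + 2) * (a ^ (N + 1) * b) * c +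
        ((N + 2).choose 2 * (a ^ N * b ^ 2) + (N + 2) * (a ^ (N + 1) * c)) * b) +
        Polynomial.C (((N + 2).choose 2 * (a ^ N * b ^ 2) + (N + 2) * (a ^ (N + 1) * c)) * c) *
          Polynomial.X, ?_⟩
    rw [show N + 1 + 2 = N + 2 + 1 by ring, pow_succ, hr, Nat.choose_succ_succ' (N + 2) 1,
      Nat.choose_one_right]
    simp only [map_add, map_mul, map_pow, map_natCast, Nat.cast_add, Nat.cast_one, map_one,
      Nat.cast_ofNat, map_ofNat]
    ring

variable {k : Type*} [Field k] {H : Type*} [AddCommGroup H] [Module k H]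

/-- The span of the powers `x^d` with `x` isotropic. -/
def isoPart (q : LinearMap.BilinForm k H) (d : ℕ) : Submodule k (SymmetricAlgebra k H) :=
  Submodule.span k {a | ∃ x : H, q x x = 0 ∧ a = SymmetricAlgebra.ι k H x ^ d}

theorem ι_pow_mem_isoPart {q : LinearMap.BilinForm k H} {x : H} (hx : q x x = 0) (d : ℕ) :
    SymmetricAlgebra.ι k H x ^ d ∈ isoPart q d :=
  Submodule.subset_span ⟨x, hx, rfl⟩

theorem isoPart_le_genPart (q : LinearMap.BilinForm k H) (d : ℕ) : isoPart q d ≤ genPart q d := by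
  refine Submodule.span_mono ?_
  rintro _ ⟨x, hx, rfl⟩
  exact ⟨x, Or.inl hx, rfl⟩

/-- The first two coefficients of the powers `(x + t v - ½ t² q(v, v) z)^(N + 2)` of isotropic
vectors. -/
theorem isoPart_of_hyperbolic [CharZero k] {q : LinearMap.BilinForm k H} (hs : q.IsSymm)
    {x z v : H} (hx : q x x = 0) (hz : q z z = 0) (hxz : q x z = 1) (hvx : q v x = 0)
    (hvz : q v z = 0) (N : ℕ) :
    SymmetricAlgebra.ι k H x ^ (N + 1) * SymmetricAlgebra.ι k H v ∈ isoPart q (N + 2) ∧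
      (N + 1 : k) • (SymmetricAlgebra.ι k H x ^ N * SymmetricAlgebra.ι k H v ^ 2) -
        q v v • (SymmetricAlgebra.ι k H x ^ (N + 1) * SymmetricAlgebra.ι k H z) ∈
          isoPart q (N + 2) := by
  set a := SymmetricAlgebra.ι k H x
  set b := SymmetricAlgebra.ι k H v
  set c := SymmetricAlgebra.ι k H ((-(q v v / 2)) • z) with hc
  obtain ⟨r, hr⟩ := exists_quadratic_pow_eq a b c N
  have hxv : q x v = 0 := by rw [hs.eq, hvx]
  have hzv : q z v = 0 := by rw [hs.eq, hvz]
  have hzx : q z x = 1 := by rw [hs.eq, hxz]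
  have key := coeff_mem_of_eval_mem (isoPart q (N + 2)) _ (fun t => by
    have h1 : q (x + t • v + t ^ 2 • (-(q v v / 2)) • z)
        (x + t • v + t ^ 2 • (-(q v v / 2)) • z) = 0 := by
      simp only [map_add, map_smul, LinearMap.add_apply, LinearMap.smul_apply, smul_eq_mul, hx, hz,
        hxz, hvx, hvz, hxv, hzv, hzx]
      ring
    have h2 := ι_pow_mem_isoPart h1 (N + 2)
    have h3 : SymmetricAlgebra.ι k H (x + t • v + t ^ 2 • (-(q v v / 2)) • z) =
        (Polynomial.C a + Polynomial.C b * Polynomial.X + Polynomial.C c * Polynomial.X ^ 2).eval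
          (algebraMap k _ t) := by
      rw [map_add, map_add, map_smul _ t, map_smul _ (t ^ 2)]
      simp only [Polynomial.eval_add, Polynomial.eval_mul, Polynomial.eval_C, Polynomial.eval_X,
        Polynomial.eval_pow, Algebra.smul_def t, Algebra.smul_def (t ^ 2), map_pow, a, b, c]
      ring
    rwa [h3, ← Polynomial.eval_pow, hr] at h2)
  have hN : (N + 2 : k) ≠ 0 := by exact_mod_cast (N + 1).succ_ne_zero
  constructor
  · have h1 := key 1
    simp only [Polynomial.coeff_add, Polynomial.coeff_C_mul, Polynomial.coeff_X_one,
      Polynomial.coeff_C_succ, Polynomial.coeff_X_pow, Polynomial.coeff_X_pow_mul'] at h1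
    norm_num at h1
    have h2 := Submodule.smul_mem _ (N + 2 : k)⁻¹ h1
    rwa [show ((N : SymmetricAlgebra k H) + 2) = algebraMap k _ (N + 2 : k) by
        rw [map_add, map_natCast, map_ofNat],
      ← Algebra.smul_def, smul_smul, inv_mul_cancel₀ hN, one_smul] at h2
  · have h1 := key 2
    simp only [Polynomial.coeff_add, Polynomial.coeff_C_mul, Polynomial.coeff_X,
      Polynomial.coeff_C_succ, Polynomial.coeff_X_pow, Polynomial.coeff_X_pow_mul'] at h1
    norm_num at h1
    have h2 := Submodule.smul_mem _ (2 * (N + 2 : k)⁻¹) h1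
    have h3 : (((N + 2).choose 2 : ℕ) : SymmetricAlgebra k H) =
        algebraMap k _ ((N + 2) * (N + 1) / 2 : k) := by
      rw [← map_natCast (algebraMap k (SymmetricAlgebra k H)), Nat.cast_choose_two]
      push_cast
      congr 1
      ring
    rw [h3, show ((N : SymmetricAlgebra k H) + 2) = algebraMap k _ (N + 2 : k) by
        rw [map_add, map_natCast, map_ofNat],
      ← Algebra.smul_def, ← Algebra.smul_def, hc, map_smul, mul_smul_comm, smul_add, smul_smul,
      smul_smul, smul_smul] at h2
    rw [sub_eq_add_neg, ← neg_smul]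
    convert h2 using 3
    · field_simp
    · field_simp

theorem exists_hyperbolic_partner [CharZero k] {q : LinearMap.BilinForm k H} (hs : q.IsSymm)
    (hq : q.Nondegenerate) {x : H} (hx : q x x = 0) (hx0 : x ≠ 0) :
    ∃ z, q z z = 0 ∧ q x z = 1 := by
  obtain ⟨y, hy⟩ : ∃ y, q x y ≠ 0 := by
    by_contra! h
    exact hx0 (hq.1 x h)
  have h1 : q x ((q x y)⁻¹ • y) = 1 := by simp [hy]
  set w := (q x y)⁻¹ • y
  have h2 : q w x = 1 := by rw [hs.eq, h1]
  refine ⟨w - (q w w / 2) • x, ?_, ?_⟩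
  · simp only [map_sub, map_smul, LinearMap.sub_apply, LinearMap.smul_apply, smul_eq_mul, h1,
      h2, hx]
    ring
  · simp [h1, hx]

theorem exists_isotropic_ne_zero {ι : Type*} [DecidableEq ι] {q : LinearMap.BilinForm k H}
    {e : Basis ι k H} [IsAlgClosed k]
    (he : ∀ i j, q (e i) (e j) = if i = j then 1 else 0)
    {i j : ι} (hij : i ≠ j) :
    ∃ c : k, c ^ 2 = -1 ∧ q (e i + c • e j) (e i + c • e j) = 0 ∧
      q (e i - c • e j) (e i - c • e j) = 0 ∧ e i + c • e j ≠ 0 := by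
  obtain ⟨c, hc⟩ := IsAlgClosed.exists_pow_nat_eq (-1 : k) (n := 2) two_pos
  refine ⟨c, hc, ?_, ?_, fun h => ?_⟩
  · simp [he, hij, hij.symm, ← pow_two, hc]
  · simp [he, hij, hij.symm, ← pow_two, hc]
  · simpa [he, hij] using congrArg (q (e i)) h

variable {ι : Type*} [Fintype ι] [DecidableEq ι] {q : LinearMap.BilinForm k H}
variable {e : Basis ι k H}

theorem symPart_one_le_isoPart [CharZero k] [IsAlgClosed k]
    (he : ∀ i j, q (e i) (e j) = if i = j then 1 else 0) (hD : 2 ≤ Fintype.card ι) :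
    symPart k H 1 ≤ isoPart q 1 := by
  rw [symPart, pow_one]
  rintro _ ⟨x, rfl⟩
  suffices h : ∀ i, SymmetricAlgebra.ι k H (e i) ∈ isoPart q 1 by
    rw [← sum_smul_orthonormal he x, map_sum]
    exact Submodule.sum_mem _ fun i _ => by
      rw [map_smul]; exact Submodule.smul_mem _ _ (h i)
  intro i
  have : Nontrivial ι := Fintype.one_lt_card_iff_nontrivial.1 hD
  obtain ⟨j, hj⟩ := exists_ne i
  obtain ⟨c, -, h1, h2, -⟩ := exists_isotropic_ne_zero he hj.symm
  have h := Submodule.smul_mem _ (2⁻¹ : k)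
    (add_mem (ι_pow_mem_isoPart h1 1) (ι_pow_mem_isoPart h2 1))
  convert h using 1
  rw [pow_one, pow_one, ← map_add, ← map_smul]
  congr 1
  rw [add_add_sub_cancel, ← two_smul k (e i), smul_smul, inv_mul_cancel₀ two_ne_zero, one_smul]

theorem genPart_le_isoPart [CharZero k] [IsAlgClosed k]
    (he : ∀ i j, q (e i) (e j) = if i = j then 1 else 0) (hD : 2 ≤ Fintype.card ι) (d : ℕ) :
    genPart q d ≤ isoPart q d := by
  refine Submodule.span_le.2 ?_
  rintro _ ⟨x, hx | hd, rfl⟩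
  · exact ι_pow_mem_isoPart hx d
  · interval_cases d
    · rw [pow_zero, ← pow_zero (SymmetricAlgebra.ι k H 0)]
      exact ι_pow_mem_isoPart (by simp) 0
    · rw [pow_one]
      exact symPart_one_le_isoPart he hD (ι_mem_symPart x)

variable [FiniteDimensional k H]

/-- Summing `isoPart_of_hyperbolic` over the orthogonal projections of the basis vectors to
`⟨x, z⟩^⊥` expresses `q x^N` through powers of isotropic vectors and `x^(N + 1) z`. -/
theorem qElt_mul_ι_pow_sub_mem [CharZero k] (hs : q.IsSymm) (hq : q.Nondegenerate)
    (he : ∀ i j, q (e i) (e j) = if i = j then 1 else 0)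
    {x z : H} (hx : q x x = 0) (hz : q z z = 0) (hxz : q x z = 1) (N : ℕ) :
    (N + 1 : k) • (qElt q hq * SymmetricAlgebra.ι k H x ^ N) -
      (2 * N + Fintype.card ι : k) •
        (SymmetricAlgebra.ι k H x ^ (N + 1) * SymmetricAlgebra.ι k H z) ∈ isoPart q (N + 2) := by
  have hzx : q z x = 1 := by rw [hs.eq, hxz]
  let v : ι → H := fun i => e i - q (e i) z • x - q (e i) x • z
  have hvx : ∀ i, q (v i) x = 0 := fun i => by simp [v, hx, hzx]
  have hvz : ∀ i, q (v i) z = 0 := fun i => by simp [v, hz, hxz]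
  have hsum : ∀ y w, ∑ i, q (e i) y * q (e i) w = q y w := fun y w => by
    conv_rhs => rw [← sum_smul_orthonormal he y]
    simp [LinearMap.sum_apply]
  have hv : ∀ i, q (v i) (v i) = 1 - 2 * (q (e i) x * q (e i) z) := fun i => by
    conv_lhs => rw [show v i = e i - q (e i) z • x - q (e i) x • z from rfl]
    simp only [map_sub, map_smul, LinearMap.sub_apply, LinearMap.smul_apply, smul_eq_mul, hx, hz,
      hxz, hzx, he, if_pos, hs.eq x (e i), hs.eq z (e i)]
    ring
  have hv1 : ∑ i, q (v i) (v i) = Fintype.card ι - 2 := by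
    simp [hv, ← Finset.mul_sum, hsum, hxz]
  have hιsum : ∀ y, ∑ i, algebraMap k _ (q (e i) y) * SymmetricAlgebra.ι k H (e i) =
      SymmetricAlgebra.ι k H y := fun y => by
    conv_rhs => rw [← sum_smul_orthonormal he y]
    simp [Algebra.smul_def]
  have hasum : ∀ y w, ∑ i, algebraMap k (SymmetricAlgebra k H) (q (e i) y) *
      algebraMap k _ (q (e i) w) = algebraMap k _ (q y w) := fun y w => by
    rw [← hsum]; simp
  have hv2 : ∑ i, SymmetricAlgebra.ι k H (v i) ^ 2 =
      qElt q hq - 2 * (SymmetricAlgebra.ι k H x * SymmetricAlgebra.ι k H z) := by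
    have h1 : ∀ i, SymmetricAlgebra.ι k H (v i) ^ 2 = SymmetricAlgebra.ι k H (e i) ^ 2
        - 2 * (SymmetricAlgebra.ι k H x *
          (algebraMap k _ (q (e i) z) * SymmetricAlgebra.ι k H (e i)))
        - 2 * (SymmetricAlgebra.ι k H z *
          (algebraMap k _ (q (e i) x) * SymmetricAlgebra.ι k H (e i)))
        + SymmetricAlgebra.ι k H x ^ 2 *
          (algebraMap k _ (q (e i) z) * algebraMap k _ (q (e i) z))
        + SymmetricAlgebra.ι k H z ^ 2 *
          (algebraMap k _ (q (e i) x) * algebraMap k _ (q (e i) x))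
        + 2 * (SymmetricAlgebra.ι k H x * SymmetricAlgebra.ι k H z *
          (algebraMap k _ (q (e i) x) * algebraMap k _ (q (e i) z))) := fun i => by
      simp only [v, map_sub, map_smul, Algebra.smul_def]
      ring
    simp only [h1, Finset.sum_add_distrib, Finset.sum_sub_distrib, ← Finset.mul_sum, hιsum, hasum,
      hx, hz, hxz, ← qElt_eq_sum hq he, map_zero, map_one]
    ring
  have h := Submodule.sum_mem (isoPart q (N + 2)) (t := Finset.univ) fun i _ =>
    (isoPart_of_hyperbolic hs hx hz hxz (hvx i) (hvz i) N).2
  rw [Finset.sum_sub_distrib, ← Finset.smul_sum, ← Finset.mul_sum, ← Finset.sum_smul, hv1, hv2] at h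
  convert h using 1
  simp only [Algebra.smul_def, map_add, map_sub, map_mul, map_one, map_natCast, map_ofNat]
  ring

/-- The vector `y` is a combination of `x`, an isotropic `z` with `q(x, z) = 1`, and a vector
orthogonal to both; the three products with `x^(N + 1)` are treated separately. -/
theorem ι_pow_mul_ι_mem [CharZero k] (hs : q.IsSymm) (hq : q.Nondegenerate)
    (he : ∀ i j, q (e i) (e j) = if i = j then 1 else 0) (hD : 2 ≤ Fintype.card ι)
    {x : H} (hx : q x x = 0) (y : H) (N : ℕ) :
    SymmetricAlgebra.ι k H x ^ (N + 1) * SymmetricAlgebra.ι k H y ∈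
      isoPart q (N + 2) ⊔ (symPart k H N).map (LinearMap.mulLeft k (qElt q hq)) := by
  by_cases hx0 : x = 0
  · simp [hx0]
  obtain ⟨z, hz, hxz⟩ := exists_hyperbolic_partner hs hq hx hx0
  have hzx : q z x = 1 := by rw [hs.eq, hxz]
  have hc : (2 * N + Fintype.card ι : k) ≠ 0 := by
    exact_mod_cast (by omega : 2 * N + Fintype.card ι ≠ 0)
  have hz' : SymmetricAlgebra.ι k H x ^ (N + 1) * SymmetricAlgebra.ι k H z ∈
      isoPart q (N + 2) ⊔ (symPart k H N).map (LinearMap.mulLeft k (qElt q hq)) := by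
    refine (Submodule.smul_mem_iff _ hc).1 ?_
    have h := neg_mem (Submodule.mem_sup_left
      (T := (symPart k H N).map (LinearMap.mulLeft k (qElt q hq)))
      (qElt_mul_ι_pow_sub_mem hs hq he hx hz hxz N))
    have h' := Submodule.mem_sup_right (S := isoPart q (N + 2)) (Submodule.mem_map_of_mem
      (f := LinearMap.mulLeft k (qElt q hq)) (ι_pow_mem_symPart (k := k) x N))
    convert add_mem h (Submodule.smul_mem _ (N + 1 : k) h') using 1
    simp
  have hv := (isoPart_of_hyperbolic hs hx hz hxz (v := y - q y z • x - q y x • z)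
    (by simp [hx, hzx]) (by simp [hz, hxz]) N).1
  have hy : SymmetricAlgebra.ι k H x ^ (N + 1) * SymmetricAlgebra.ι k H y =
      SymmetricAlgebra.ι k H x ^ (N + 1) *
        SymmetricAlgebra.ι k H (y - q y z • x - q y x • z) +
      q y z • SymmetricAlgebra.ι k H x ^ (N + 2) +
      q y x • (SymmetricAlgebra.ι k H x ^ (N + 1) * SymmetricAlgebra.ι k H z) := by
    simp only [map_sub, map_smul, Algebra.smul_def]
    ring
  rw [hy]
  exact add_mem (add_mem (Submodule.mem_sup_left hv) (Submodule.smul_mem _ _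
    (Submodule.mem_sup_left (ι_pow_mem_isoPart hx _)))) (Submodule.smul_mem _ _ hz')

theorem symPart_le_isoPart_sup [CharZero k] [IsAlgClosed k] (hs : q.IsSymm) (hq : q.Nondegenerate)
    (he : ∀ i j, q (e i) (e j) = if i = j then 1 else 0) (hD : 2 ≤ Fintype.card ι) (m : ℕ) :
    symPart k H (m + 2) ≤
      isoPart q (m + 2) ⊔ (symPart k H m).map (LinearMap.mulLeft k (qElt q hq)) := by
  have key : ∀ m (y : H), ∀ a ∈ isoPart q (m + 1), SymmetricAlgebra.ι k H y * a ∈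
      isoPart q (m + 2) ⊔ (symPart k H m).map (LinearMap.mulLeft k (qElt q hq)) := by
    intro m y a ha
    refine (Submodule.span_le (p := Submodule.comap
      (LinearMap.mulLeft k (SymmetricAlgebra.ι k H y)) (isoPart q (m + 2) ⊔
        (symPart k H m).map (LinearMap.mulLeft k (qElt q hq))))).2 ?_ ha
    rintro _ ⟨x, hx, rfl⟩
    rw [SetLike.mem_coe, Submodule.mem_comap, LinearMap.mulLeft_apply, mul_comm]
    exact ι_pow_mul_ι_mem hs hq he hD hx y m
  induction m with
  | zero => exact symPart_succ_le fun y a ha => key 0 y a (symPart_one_le_isoPart he hD ha)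
  | succ m ih =>
    refine symPart_succ_le fun y a ha => ?_
    obtain ⟨p, hp, g, hg, rfl⟩ := Submodule.mem_sup.1 (ih ha)
    obtain ⟨b, hb, rfl⟩ := Submodule.mem_map.1 hg
    rw [mul_add]
    refine add_mem (key (m + 1) y p hp)
      (Submodule.mem_sup_right ⟨SymmetricAlgebra.ι k H y * b, ?_, ?_⟩)
    · rw [add_comm m 1]
      exact symPart_mul_mem (ι_mem_symPart y) hb
    · simp only [LinearMap.mulLeft_apply]
      ring

theorem symPart_le_of_card_eq_one (hq : q.Nondegenerate)
    (he : ∀ i j, q (e i) (e j) = if i = j then 1 else 0) (hD : Fintype.card ι = 1) (m : ℕ) :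
    symPart k H (m + 2) ≤ (symPart k H m).map (LinearMap.mulLeft k (qElt q hq)) := by
  obtain ⟨i, hi⟩ := Fintype.card_eq_one_iff.1 hD
  have hu : (Finset.univ : Finset ι) = {i} := by ext j; simp [hi j]
  have hx : ∀ x, SymmetricAlgebra.ι k H x = q (e i) x • SymmetricAlgebra.ι k H (e i) := fun x => by
    conv_lhs => rw [← sum_smul_orthonormal he x]
    simp [hu]
  have hQ : qElt q hq = SymmetricAlgebra.ι k H (e i) ^ 2 := by simp [qElt_eq_sum hq he, hu]
  refine symPart_succ_le fun x a ha => ?_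
  refine symPart_succ_le (P := Submodule.comap (LinearMap.mulLeft k (SymmetricAlgebra.ι k H x))
    ((symPart k H m).map (LinearMap.mulLeft k (qElt q hq)))) (fun y b hb => ?_) ha
  refine ⟨(q (e i) x * q (e i) y) • b, Submodule.smul_mem _ _ hb, ?_⟩
  simp only [LinearMap.mulLeft_apply, hQ]
  rw [hx x, hx y]
  simp only [Algebra.smul_def, map_mul]
  ring

theorem symPart_le_genPart_sup [CharZero k] [IsAlgClosed k] (hs : q.IsSymm) (hq : q.Nondegenerate)
    (he : ∀ i j, q (e i) (e j) = if i = j then 1 else 0) (hD : 0 < Fintype.card ι) (m : ℕ) :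
    symPart k H (m + 2) ≤
      genPart q (m + 2) ⊔ (symPart k H m).map (LinearMap.mulLeft k (qElt q hq)) := by
  rcases Nat.lt_or_ge 1 (Fintype.card ι) with h | h
  · exact (symPart_le_isoPart_sup hs hq he h m).trans (sup_le_sup_right (isoPart_le_genPart _ _) _)
  · exact (symPart_le_of_card_eq_one hq he (by omega) m).trans le_sup_right

/-- By induction on `j`: `qElt_mul_ι_pow_sub_mem` expresses `q^(j + 1) x^d` through `q^j` times
powers of isotropic vectors of exponents `d + 1` and `d + 2`. -/
theorem fSpan_le_isotropicIdeal [CharZero k] [IsAlgClosed k] (hs : q.IsSymm) (hq : q.Nondegenerate)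
    (he : ∀ i j, q (e i) (e j) = if i = j then 1 else 0) (hD : 2 ≤ Fintype.card ι) (n : ℕ) :
    fSpan q hq n ≤ (isotropicIdeal q n).restrictScalars k := by
  have key : ∀ j d, n < j + d → ∀ p ∈ isoPart q d, qElt q hq ^ j * p ∈ isotropicIdeal q n := by
    intro j
    induction j with
    | zero =>
      intro d hd p hp
      rw [pow_zero, one_mul]
      refine (Submodule.span_le (p := (isotropicIdeal q n).restrictScalars k)).2 ?_ hp
      rintro _ ⟨x, hx, rfl⟩
      obtain ⟨c, rfl⟩ : ∃ c, d = c + (n + 1) := ⟨d - (n + 1), by omega⟩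
      rw [pow_add]
      exact Ideal.mul_mem_left _ _ (Ideal.subset_span ⟨x, hx, rfl⟩)
    | succ j ih =>
      intro d hd p hp
      -- it suffices to treat `x^d` with `x` isotropic and nonzero
      have h1 : ∀ x : H, q x x = 0 → x ≠ 0 →
          qElt q hq ^ (j + 1) * SymmetricAlgebra.ι k H x ^ d ∈ isotropicIdeal q n := by
        intro x hx hx0
        obtain ⟨z, hz, hxz⟩ := exists_hyperbolic_partner hs hq hx hx0
        have h2 := ih (d + 2) (by omega) _ (qElt_mul_ι_pow_sub_mem hs hq he hx hz hxz d)
        have h3 := ih (d + 1) (by omega) _ (ι_pow_mem_isoPart hx (d + 1))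
        have h4 := add_mem h2 (Ideal.mul_mem_left _
          (algebraMap k _ (2 * d + Fintype.card ι : k) * SymmetricAlgebra.ι k H z) h3)
        have h5 := Ideal.mul_mem_left _ (algebraMap k _ (d + 1 : k)⁻¹) h4
        have hd1 : (d + 1 : k) ≠ 0 := Nat.cast_add_one_ne_zero d
        convert h5 using 1
        have h6 : algebraMap k (SymmetricAlgebra k H) (d + 1 : k)⁻¹ *
            algebraMap k _ (d + 1 : k) = 1 := by
          rw [← map_mul, inv_mul_cancel₀ hd1, map_one]
        simp only [Algebra.smul_def]
        linear_combination (-(qElt q hq ^ (j + 1) * SymmetricAlgebra.ι k H x ^ d)) * h6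
      refine (Submodule.span_le (p := ((isotropicIdeal q n).restrictScalars k).comap
        (LinearMap.mulLeft k (qElt q hq ^ (j + 1))))).2 ?_ hp
      rintro _ ⟨x, hx, rfl⟩
      by_cases hx0 : x = 0
      · cases d with
        | zero =>
          have : Nontrivial ι := Fintype.one_lt_card_iff_nontrivial.1 hD
          obtain ⟨i, i', hi⟩ := exists_pair_ne ι
          obtain ⟨c, -, h2, -, h3⟩ := exists_isotropic_ne_zero he hi
          simpa using h1 _ h2 h3
        | succ d => simp [hx0]
      · exact h1 x hx hx0
  refine Submodule.span_le.2 ?_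
  rintro _ ⟨j, d, hjd, p, hp, rfl⟩
  exact key j d hjd p (genPart_le_isoPart he hD d hp)

end Isotropic

/-! ### Powers of a two-form in the exterior algebra -/

section Exterior

variable {k : Type*} [Field k]

theorem exteriorPower_eq_bot {W : Type*} [AddCommGroup W] [Module k W] [FiniteDimensional k W]
    {m : ℕ} (h : finrank k W < m) : ⋀[k]^m W = ⊥ := by
  rw [← Submodule.finrank_eq_zero (R := k), exteriorPower.finrank_eq, Nat.choose_eq_zero_of_lt h]

theorem ι_mul_ι_swap {W : Type*} [AddCommGroup W] [Module k W] (f g : W) :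
    ExteriorAlgebra.ι k f * ExteriorAlgebra.ι k g =
      -(ExteriorAlgebra.ι k g * ExteriorAlgebra.ι k f) :=
  eq_neg_of_add_eq_zero_left (ExteriorAlgebra.ι_add_mul_swap f g)

/-- Euler's identity in the exterior algebra. -/
theorem sum_ι_mul_contractLeft {W κ : Type*} [AddCommGroup W] [Module k W] [Fintype κ]
    (b : Basis κ k W) (m : ℕ) : ∀ η ∈ ⋀[k]^m W,
      ∑ i, ExteriorAlgebra.ι k (b i) * CliffordAlgebra.contractLeft (b.coord i) η =
        (m : k) • η := by
  induction m with
  | zero =>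
    intro η hη
    rw [ExteriorAlgebra.exteriorPower, pow_zero] at hη
    obtain ⟨r, rfl⟩ := Submodule.mem_one.1 hη
    simp [CliffordAlgebra.contractLeft_algebraMap]
  | succ m ih =>
    intro η hη
    rw [ExteriorAlgebra.exteriorPower, pow_succ'] at hη
    induction hη using Submodule.mul_induction_on' with
    | add x _ y _ hx hy => simp only [map_add, mul_add, Finset.sum_add_distrib, hx, hy, smul_add]
    | mem_mul_mem x hx η hη =>
      obtain ⟨w, rfl⟩ := hx
      have h1 : ∑ i, ExteriorAlgebra.ι k (b i) *
          (b.coord i w • η) = ExteriorAlgebra.ι k w * η := by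
        conv_rhs => rw [← b.sum_repr w, map_sum, Finset.sum_mul]
        exact Finset.sum_congr rfl fun i _ => by simp
      have h2 : ∑ i, ExteriorAlgebra.ι k (b i) *
          (ExteriorAlgebra.ι k w * CliffordAlgebra.contractLeft (b.coord i) η) =
            -((m : k) • (ExteriorAlgebra.ι k w * η)) := by
        rw [← mul_smul_comm, ← ih η hη, Finset.mul_sum, ← Finset.sum_neg_distrib]
        refine Finset.sum_congr rfl fun i _ => ?_
        rw [← mul_assoc, ← mul_assoc, ι_mul_ι_swap, neg_mul]
      simp only [CliffordAlgebra.contractLeft_ι_mul, mul_sub, Finset.sum_sub_distrib]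
      rw [h1, h2]
      push_cast
      rw [add_smul, one_smul, sub_neg_eq_add, add_comm]

/-- A nonzero homogeneous element that is annihilated by all vectors has top degree. -/
theorem eq_finrank_of_forall_ι_mul_eq_zero [CharZero k] {W : Type*} [AddCommGroup W] [Module k W]
    [FiniteDimensional k W] {m : ℕ} {η : ExteriorAlgebra k W} (hη : η ∈ ⋀[k]^m W) (h0 : η ≠ 0)
    (h : ∀ w, ExteriorAlgebra.ι k w * η = 0) : m = finrank k W := by
  have b := finBasis k W
  have h1 := sum_ι_mul_contractLeft b m η hη
  have h2 : ∀ i, ExteriorAlgebra.ι k (b i) * CliffordAlgebra.contractLeft (b.coord i) η = η := by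
    intro i
    have h3 := CliffordAlgebra.contractLeft_ι_mul (Q := 0) (b.coord i) (b i) η
    rw [show CliffordAlgebra.ι (0 : QuadraticForm k W) (b i) * η = 0 from h (b i), map_zero] at h3
    have h4 : b.coord i (b i) = 1 := by simp
    rw [h4, one_smul] at h3
    exact (sub_eq_zero.1 h3.symm).symm
  simp only [h2, Finset.sum_const, Finset.card_univ, Fintype.card_fin,
    ← Nat.cast_smul_eq_nsmul k] at h1
  have h5 := smul_left_injective k h0 h1
  exact_mod_cast h5.symm

variable {V : Type*} [AddCommGroup V] [Module k V] [FiniteDimensional k V]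

/-- Induction on bilinear forms: they are sums of products of two linear forms. -/
theorem bilinForm_induction {P : LinearMap.BilinForm k V → Prop} (B : LinearMap.BilinForm k V)
    (h0 : P 0) (hadd : ∀ B C, P B → P C → P (B + C))
    (hmul : ∀ f g : Dual k V, P (dualTensorHom k V (Dual k V) (f ⊗ₜ g))) : P B := by
  obtain ⟨t, rfl⟩ := (dualTensorHomEquiv k V (Dual k V)).surjective B
  induction t using TensorProduct.induction_on with
  | zero => rw [map_zero]; exact h0
  | tmul f g => exact hmul f g
  | add s t hs ht => rw [map_add]; exact hadd _ _ hs ht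

theorem formToExt_dualTensorHom (f g : Dual k V) :
    formToExt (dualTensorHom k V (Dual k V) (f ⊗ₜ g)) =
      (2⁻¹ : k) • (ExteriorAlgebra.ι k f * ExteriorAlgebra.ι k g) := by
  simp [formToExt]

theorem formToExt_mem (B : LinearMap.BilinForm k V) : formToExt B ∈ ⋀[k]^2 (Dual k V) := by
  induction B using bilinForm_induction with
  | h0 => simp
  | hadd B C hB hC => rw [map_add]; exact add_mem hB hC
  | hmul f g =>
    rw [formToExt_dualTensorHom, ExteriorAlgebra.exteriorPower, pow_two]
    exact Submodule.smul_mem _ _ (Submodule.mul_mem_mul ⟨f, rfl⟩ ⟨g, rfl⟩)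

theorem formToExt_mul_ι (B : LinearMap.BilinForm k V) (f : Dual k V) :
    formToExt B * ExteriorAlgebra.ι k f = ExteriorAlgebra.ι k f * formToExt B := by
  induction B using bilinForm_induction with
  | h0 => simp
  | hadd B C hB hC => rw [map_add, add_mul, hB, hC, mul_add]
  | hmul g h =>
    rw [formToExt_dualTensorHom, smul_mul_assoc, mul_smul_comm, mul_assoc, ι_mul_ι_swap h f,
      mul_neg, ← mul_assoc, ι_mul_ι_swap g f, neg_mul, neg_neg, mul_assoc]

theorem formToExt_mul_comm (B C : LinearMap.BilinForm k V) :
    formToExt B * formToExt C = formToExt C * formToExt B := by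
  induction C using bilinForm_induction with
  | h0 => simp
  | hadd C D hC hD => rw [map_add, add_mul, mul_add, hC, hD]
  | hmul f g =>
    rw [formToExt_dualTensorHom, smul_mul_assoc, mul_smul_comm, ← mul_assoc, formToExt_mul_ι,
      mul_assoc, formToExt_mul_ι, mul_assoc]

/-- The contraction of the two-form `B` with `v` is the linear form `B v`, and contraction obeys the
Leibniz rule without a sign for left multiplication by two-forms. -/
theorem contractLeft_formToExt_mul [CharZero k] {B : LinearMap.BilinForm k V}
    (hB : ∀ u v, B u v = -B v u) (v : V) (η : ExteriorAlgebra k (Dual k V)) :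
    CliffordAlgebra.contractLeft (Dual.eval k V v) (formToExt B * η) =
      ExteriorAlgebra.ι k (B v) * η +
        formToExt B * CliffordAlgebra.contractLeft (Dual.eval k V v) η := by
  have h : ∀ B : LinearMap.BilinForm k V,
      CliffordAlgebra.contractLeft (Dual.eval k V v) (formToExt B * η) =
        (2⁻¹ : k) • (ExteriorAlgebra.ι k (B v - LinearMap.flip B v) * η) +
          formToExt B * CliffordAlgebra.contractLeft (Dual.eval k V v) η := by
    intro B
    induction B using bilinForm_induction with
    | h0 => simp [show LinearMap.flip (0 : LinearMap.BilinForm k V) v = 0 from rfl]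
    | hadd B C hB hC =>
      rw [map_add, add_mul, map_add, hB, hC, add_mul, LinearMap.add_apply,
        show LinearMap.flip (B + C) v = LinearMap.flip B v + LinearMap.flip C v from rfl,
        add_sub_add_comm, map_add, add_mul, smul_add]
      abel
    | hmul f g =>
      have h1 : dualTensorHom k V (Dual k V) (f ⊗ₜ g) v = f v • g := by ext; simp
      have h2 : LinearMap.flip (dualTensorHom k V (Dual k V) (f ⊗ₜ g)) v = g v • f := by
        ext; simp [mul_comm]
      rw [formToExt_dualTensorHom, h1, h2, smul_mul_assoc, map_smul, mul_assoc,
        CliffordAlgebra.contractLeft_ι_mul, CliffordAlgebra.contractLeft_ι_mul, smul_mul_assoc,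
        ← smul_add]
      congr 1
      simp only [map_sub, map_smul, sub_mul, smul_mul_assoc, mul_sub, mul_smul_comm, mul_assoc,
        Dual.eval_apply]
      abel
  have h3 : LinearMap.flip B v = -B v := by ext u; simp [hB u v]
  rw [h, h3, sub_neg_eq_add, ← two_smul k (B v), map_smul, smul_mul_assoc, smul_smul,
    inv_mul_cancel₀ two_ne_zero, one_smul]

theorem contractLeft_formToExt_pow [CharZero k] {B : LinearMap.BilinForm k V}
    (hB : ∀ u v, B u v = -B v u) (v : V) (s : ℕ) :
    CliffordAlgebra.contractLeft (Dual.eval k V v) (formToExt B ^ (s + 1)) =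
      ((s + 1 : ℕ) : k) • (ExteriorAlgebra.ι k (B v) * formToExt B ^ s) := by
  induction s with
  | zero =>
    have h := contractLeft_formToExt_mul hB v 1
    rw [CliffordAlgebra.contractLeft_one, mul_one, mul_one, mul_zero, add_zero] at h
    simpa using h
  | succ s ih =>
    rw [pow_succ', contractLeft_formToExt_mul hB, ih, mul_smul_comm, ← mul_assoc, formToExt_mul_ι,
      mul_assoc, ← pow_succ']
    push_cast
    module

theorem formToExt_pow_mem (B : LinearMap.BilinForm k V) (s : ℕ) :
    formToExt B ^ s ∈ ⋀[k]^(2 * s) (Dual k V) := by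
  rw [ExteriorAlgebra.exteriorPower, pow_mul]
  exact Submodule.pow_mem_pow _ (formToExt_mem B) s

/-- The exterior powers of a symplectic form do not vanish up to the top degree. -/
theorem formToExt_pow_ne_zero [CharZero k] {B : LinearMap.BilinForm k V}
    (hB : ∀ u v, B u v = -B v u) (hinj : Function.Injective B) (s : ℕ)
    (hs : 2 * s ≤ finrank k V) : formToExt B ^ s ≠ 0 := by
  induction s with
  | zero => simp
  | succ s ih =>
    intro h0
    have hsurj : Function.Surjective B :=
      (LinearMap.injective_iff_surjective_of_finrank_eq_finrank
        (Subspace.dual_finrank_eq (K := k) (V := V)).symm).1 hinj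
    have h1 := eq_finrank_of_forall_ι_mul_eq_zero (formToExt_pow_mem B s) (ih (by omega))
      (fun w => by
        obtain ⟨v, rfl⟩ := hsurj w
        have h2 := contractLeft_formToExt_pow hB v s
        rw [h0, map_zero] at h2
        exact (smul_eq_zero.1 h2.symm).resolve_left (Nat.cast_ne_zero.2 s.succ_ne_zero))
    rw [Subspace.dual_finrank_eq] at h1
    omega

theorem formToExt_compl₁₂ {V' : Type*} [AddCommGroup V'] [Module k V'] [FiniteDimensional k V']
    (p : V →ₗ[k] V') (B : LinearMap.BilinForm k V') :
    formToExt (B.compl₁₂ p p) = ExteriorAlgebra.map p.dualMap (formToExt B) := by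
  induction B using bilinForm_induction with
  | h0 =>
    rw [show (0 : LinearMap.BilinForm k V').compl₁₂ p p = 0 from rfl, map_zero, map_zero, map_zero]
  | hadd B C hB hC =>
    rw [show (B + C).compl₁₂ p p = B.compl₁₂ p p + C.compl₁₂ p p from rfl, map_add, map_add, hB,
      hC, map_add]
  | hmul f g =>
    have h : (dualTensorHom k V' (Dual k V') (f ⊗ₜ g)).compl₁₂ p p =
        dualTensorHom k V (Dual k V) (p.dualMap f ⊗ₜ p.dualMap g) := by
      ext; simp
    rw [h, formToExt_dualTensorHom, formToExt_dualTensorHom, map_smul, map_mul,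
      ExteriorAlgebra.map_apply_ι, ExteriorAlgebra.map_apply_ι]

/-- A skew form of rank less than `2 s` descends to a space of dimension less than `2 s`, so
that its `s`-th exterior power vanishes. -/
theorem formToExt_pow_eq_zero {B : LinearMap.BilinForm k V}
    (hB : ∀ u v, B u v = -B v u) (s : ℕ) (hs : finrank k (LinearMap.range B) < 2 * s) :
    formToExt B ^ s = 0 := by
  let B' : LinearMap.BilinForm k (V ⧸ LinearMap.ker B) :=
    LinearMap.liftQ₂ (LinearMap.ker B) (LinearMap.ker B) B le_rfl fun v hv => by
      rw [LinearMap.mem_ker] at hv ⊢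
      ext u
      rw [LinearMap.flip_apply, hB, hv]
      simp
  have h1 : B = B'.compl₁₂ (LinearMap.ker B).mkQ (LinearMap.ker B).mkQ := rfl
  have h2 : formToExt B' ^ s = 0 := by
    rw [← Submodule.mem_bot k, ← exteriorPower_eq_bot (k := k) (W := Dual k (V ⧸ LinearMap.ker B))
      (m := 2 * s)]
    · exact formToExt_pow_mem B' s
    · rwa [Subspace.dual_finrank_eq, B.quotKerEquivRange.finrank_eq]
  rw [h1, formToExt_compl₁₂, ← map_pow, h2, map_zero]

end Exterior

/-! ### The forms `ω_x` and the algebra they generate -/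

section Clifford

variable {k : Type*} [Field k] {H : Type*} [AddCommGroup H] [Module k H]
variable {V : Type*} [AddCommGroup V] [Module k V]
variable {q : LinearMap.BilinForm k H} [Module (Cl q) V] [IsScalarTower k (Cl q) V]
variable {τ : LinearMap.BilinForm k V}

theorem omegaForm_skew (hτs : τ.IsSymm) (hτi : IsClInvariant q τ) (x : H) (u v : V) :
    omegaForm q τ x u v = -omegaForm q τ x v u := by
  rw [omegaForm_apply, omegaForm_apply, hτi, clBar, CliffordAlgebra.reverse_ι,
    CliffordAlgebra.involute_ι, neg_smul, map_neg, hτs.eq]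

theorem ι_smul_ι_smul (x : H) (u : V) :
    CliffordAlgebra.ι (LinearMap.BilinMap.toQuadraticMap q) x •
      CliffordAlgebra.ι (LinearMap.BilinMap.toQuadraticMap q) x • u = q x x • u := by
  rw [smul_smul, CliffordAlgebra.ι_sq_scalar, algebraMap_smul]
  rfl

theorem omegaForm_injective (hτ : τ.Nondegenerate) {x : H} (hx : q x x ≠ 0) :
    Function.Injective (omegaForm q τ x) := by
  rw [← LinearMap.ker_eq_bot, LinearMap.ker_eq_bot']
  intro u hu
  have h1 := hτ.1 (CliffordAlgebra.ι (LinearMap.BilinMap.toQuadraticMap q) x • u)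
    fun v => by rw [← omegaForm_apply, hu, LinearMap.zero_apply]
  have h2 := ι_smul_ι_smul (q := q) x u
  rw [h1, smul_zero] at h2
  exact (smul_eq_zero.1 h2.symm).resolve_left hx

variable [FiniteDimensional k V]

theorem two_mul_finrank_range_omegaForm_le {x : H} (hx : q x x = 0) :
    2 * finrank k (LinearMap.range (omegaForm q τ x)) ≤ finrank k V := by
  -- the action `T` of `x` on `V` has square zero, so that its rank is at most half the dimension
  let T : End k V := Algebra.lsmul k k V (CliffordAlgebra.ι (LinearMap.BilinMap.toQuadraticMap q) x)
  have h1 : omegaForm q τ x = τ ∘ₗ T := rfl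
  have h2 : LinearMap.range T ≤ LinearMap.ker T := by
    rintro _ ⟨u, rfl⟩
    exact (ι_smul_ι_smul (q := q) x u).trans (by rw [hx, zero_smul])
  have h3 := Submodule.finrank_mono h2
  have h4 := T.finrank_range_add_finrank_ker
  have h5 : finrank k (LinearMap.range (τ ∘ₗ T)) ≤ finrank k (LinearMap.range T) := by
    rw [LinearMap.range_comp]
    exact Submodule.finrank_map_le _ _
  rw [h1]
  omega

theorem phi_pow_eq_zero (hτs : τ.IsSymm) (hτi : IsClInvariant q τ) {n : ℕ}
    (hn : finrank k V = 4 * n) {x : H} (hx : q x x = 0) : phi q τ x ^ (n + 1) = 0 := by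
  refine formToExt_pow_eq_zero (omegaForm_skew hτs hτi x) (n + 1) ?_
  have := two_mul_finrank_range_omegaForm_le (τ := τ) hx
  omega

theorem phi_pow_ne_zero [CharZero k] (hτs : τ.IsSymm) (hτ : τ.Nondegenerate)
    (hτi : IsClInvariant q τ) {n : ℕ}
    (hn : finrank k V = 4 * n) {x : H} (hx : q x x ≠ 0) : phi q τ x ^ (2 * n) ≠ 0 :=
  formToExt_pow_ne_zero (omegaForm_skew hτs hτi x) (omegaForm_injective hτ hx) _ (by omega)

variable (q τ)

/-- The algebra `A^•` is commutative, since two-forms commute. -/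
instance : CommRing (subalgebraA q τ) where
  __ := (subalgebraA q τ).toRing
  mul_comm := by
    have := Algebra.isMulCommutative_adjoin k
      (s := (LinearMap.range (phi q τ) : Set (ExteriorAlgebra k (Dual k V)))) (by
        rintro _ ⟨x, rfl⟩ _ ⟨y, rfl⟩
        exact formToExt_mul_comm _ _)
    exact this.is_comm.comm

/-- The homomorphism `S^• H → A^•`, `x ↦ ω_x`. -/
def symToA : SymmetricAlgebra k H →ₐ[k] subalgebraA q τ :=
  SymmetricAlgebra.lift ((phi q τ).codRestrict (Subalgebra.toSubmodule (subalgebraA q τ))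
    fun x => Algebra.subset_adjoin ⟨x, rfl⟩)

theorem coe_symToA_ι (x : H) :
    (symToA q τ (SymmetricAlgebra.ι k H x) : ExteriorAlgebra k (Dual k V)) = phi q τ x := by
  rw [symToA, SymmetricAlgebra.lift_ι_apply]
  rfl

theorem symToA_surjective : Function.Surjective (symToA q τ) := by
  have h : subalgebraA q τ ≤ ((subalgebraA q τ).val.comp (symToA q τ)).range := by
    refine Algebra.adjoin_le ?_
    rintro _ ⟨x, rfl⟩
    exact ⟨SymmetricAlgebra.ι k H x, coe_symToA_ι q τ x⟩
  intro a
  obtain ⟨s, hs⟩ := h a.2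
  exact ⟨s, Subtype.ext hs⟩

theorem coe_symToA_mem (i : ℕ) {s : SymmetricAlgebra k H} (hs : s ∈ symPart k H i) :
    (symToA q τ s : ExteriorAlgebra k (Dual k V)) ∈ ⋀[k]^(2 * i) (Dual k V) := by
  let F : SymmetricAlgebra k H →ₐ[k] ExteriorAlgebra k (Dual k V) :=
    (subalgebraA q τ).val.comp (symToA q τ)
  have h : (symPart k H i).map F.toLinearMap ≤ ⋀[k]^(2 * i) (Dual k V) := by
    rw [symPart, Submodule.map_pow, ExteriorAlgebra.exteriorPower, pow_mul]
    refine pow_le_pow_left' ?_ i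
    rintro _ ⟨_, ⟨x, rfl⟩, rfl⟩
    change (symToA q τ (SymmetricAlgebra.ι k H x) : ExteriorAlgebra k (Dual k V)) ∈ _
    rw [coe_symToA_ι]
    exact formToExt_mem _
  exact h ⟨s, hs, rfl⟩

theorem exists_finsupp_symPart (s : SymmetricAlgebra k H) :
    ∃ c : ℕ →₀ SymmetricAlgebra k H, (∀ i, c i ∈ symPart k H i) ∧ ∑ i ∈ c.support, c i = s :=
  (Submodule.mem_iSup_iff_exists_finsupp _ s).1 (iSup_symPart (k := k) (H := H) ▸ trivial)

/-- If the image of `s` is homogeneous of degree `j`, then the components of `s` of degrees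
other than `j / 2` are mapped to zero. -/
theorem symToA_eq_zero_of_sum_mem {c : ℕ →₀ SymmetricAlgebra k H}
    (hc : ∀ i, c i ∈ symPart k H i) {j : ℕ}
    (h : (symToA q τ (∑ i ∈ c.support, c i) : ExteriorAlgebra k (Dual k V)) ∈
      ⋀[k]^j (Dual k V)) {i : ℕ} (hij : 2 * i ≠ j) : symToA q τ (c i) = 0 := by
  let A : ℕ → Submodule k (ExteriorAlgebra k (Dual k V)) := fun i => ⋀[k]^i (Dual k V)
  have h1 : (DirectSum.decompose A (symToA q τ (∑ i ∈ c.support, c i) :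
      ExteriorAlgebra k (Dual k V)) (2 * i) : ExteriorAlgebra k (Dual k V)) = 0 :=
    DirectSum.decompose_of_mem_ne A h hij.symm
  rw [map_sum, AddSubmonoidClass.coe_finsetSum, DirectSum.decompose_sum, DFinsupp.finsetSum_apply,
    AddSubmonoidClass.coe_finsetSum] at h1
  have h2 : ∀ i' ∈ c.support, i' ≠ i → (DirectSum.decompose A (symToA q τ (c i') :
      ExteriorAlgebra k (Dual k V)) (2 * i) : ExteriorAlgebra k (Dual k V)) = 0 :=
    fun i' _ hi' => DirectSum.decompose_of_mem_ne A (coe_symToA_mem q τ i' (hc i')) (by omega)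
  have h3 : i ∉ c.support → (DirectSum.decompose A (symToA q τ (c i) :
      ExteriorAlgebra k (Dual k V)) (2 * i) : ExteriorAlgebra k (Dual k V)) = 0 := fun hi => by
    rw [Finsupp.notMem_support_iff.1 hi]
    simp
  rw [Finset.sum_eq_single i h2 h3,
    DirectSum.decompose_of_mem_same A (coe_symToA_mem q τ i (hc i))] at h1
  exact Subtype.ext h1

variable {q τ}

theorem isotropicIdeal_le_ker (hτs : τ.IsSymm) (hτi : IsClInvariant q τ) {n : ℕ}
    (hn : finrank k V = 4 * n) : isotropicIdeal q n ≤ RingHom.ker (symToA q τ) := by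
  refine Ideal.span_le.2 ?_
  rintro _ ⟨x, hx, rfl⟩
  rw [SetLike.mem_coe, RingHom.mem_ker]
  refine Subtype.ext ?_
  rw [map_pow, SubmonoidClass.coe_pow, coe_symToA_ι, phi_pow_eq_zero hτs hτi hn hx]
  rfl

theorem symToA_eq_zero_of_lt {n m : ℕ} (hn : finrank k V = 4 * n) (hm : 2 * n < m)
    {s : SymmetricAlgebra k H} (hs : s ∈ symPart k H m) : symToA q τ s = 0 := by
  have h := coe_symToA_mem q τ m hs
  rw [exteriorPower_eq_bot (by rw [Subspace.dual_finrank_eq]; omega), Submodule.mem_bot] at h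
  exact Subtype.ext h

end Clifford

/-! ### The kernel of `S^• H → A^•` -/

section Comparison

variable {k : Type*} [Field k] {H : Type*} [AddCommGroup H] [Module k H] [FiniteDimensional k H]
variable {ι : Type*} [Fintype ι] [DecidableEq ι] {q : LinearMap.BilinForm k H}
variable {e : Basis ι k H}

theorem fSpan_le_fIdeal [CharZero k] (hs : q.IsSymm) (hq : q.Nondegenerate)
    (he : ∀ i j, q (e i) (e j) = if i = j then 1 else 0) (hD : 0 < Fintype.card ι) (n : ℕ) :
    fSpan q hq n ≤ (fIdeal q hq n).restrictScalars k := by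
  refine Submodule.span_le.2 ?_
  rintro _ ⟨j, d, hjd, p, hp, rfl⟩
  refine Ideal.subset_span (Set.mem_iUnion.2 ⟨2 * j + d - n, ?_, fun t ht g hg => ?_⟩)
  · rw [show n + (2 * j + d - n) = 2 * j + d by omega]
    exact qElt_pow_mul_mem hq he (genPart_le_symPart q d hp) j
  · exact symPairing_fSpan hs hq he hD
      (Submodule.subset_span ⟨j, d, by omega, p, hp, rfl⟩) hg

/-- The operator `∂_q^r` is injective on `q^r S^t H`. -/
theorem eq_zero_of_diffOp_qElt_pow_qElt_pow_mul [CharZero k] (hs : q.IsSymm) (hq : q.Nondegenerate)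
    (he : ∀ i j, q (e i) (e j) = if i = j then 1 else 0) (hD : 0 < Fintype.card ι)
    (hdec : ∀ m, symPart k H (m + 2) ≤
      genPart q (m + 2) ⊔ (symPart k H m).map (LinearMap.mulLeft k (qElt q hq)))
    {t r : ℕ} {g : SymmetricAlgebra k H} (hg : g ∈ symPart k H t)
    (h : diffOp q (qElt q hq ^ r) (qElt q hq ^ r * g) = 0) : g = 0 := by
  obtain ⟨p, hp, rfl⟩ := exists_sum_qElt_pow_mul hq hdec _ g hg
  choose c hc0 hc using fun i => exists_diffOp_qElt_pow_mul hs hq he hD (t - 2 * i) i r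
  have h1 : ∀ i < t / 2 + 1, c i • p i = 0 := by
    refine eq_zero_of_sum_qElt_pow_mul hs hq he hD (fun i => t - 2 * i) _ 0 (t / 2 + 1)
      (fun i hi => Submodule.smul_mem _ _ (hp i hi)) ?_
    rw [Finset.mul_sum, map_sum] at h
    rw [← h]
    refine Finset.sum_congr rfl fun i hi => ?_
    rw [Finset.mem_range] at hi
    rw [← mul_assoc, ← pow_add, add_comm r, hc i (p i) (hp i hi), zero_add, mul_smul_comm]
  refine Finset.sum_eq_zero fun i hi => ?_
  rw [(smul_eq_zero.1 (h1 i (Finset.mem_range.1 hi))).resolve_left (hc0 i), mul_zero]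

theorem R_subset_fSpan [CharZero k] (hs : q.IsSymm) (hq : q.Nondegenerate)
    (he : ∀ i j, q (e i) (e j) = if i = j then 1 else 0) (hD : 0 < Fintype.card ι)
    (hdec : ∀ m, symPart k H (m + 2) ≤
      genPart q (m + 2) ⊔ (symPart k H m).map (LinearMap.mulLeft k (qElt q hq)))
    (n r : ℕ) : R q hq n r ⊆ fSpan q hq n := by
  rintro f ⟨hf, hf'⟩
  rcases lt_or_ge n r with hr | hr
  · exact mem_fSpan_of_lt hq hdec (by omega) hf
  obtain ⟨t, rfl⟩ := Nat.exists_eq_add_of_le' hr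
  rw [show t + r + r = t + 2 * r by ring] at hf
  obtain ⟨l, hl, g, hg, rfl⟩ := exists_eq_add_qElt_pow_mul hq he hdec hf
  suffices h : g = 0 by simpa [h] using hl
  refine eq_zero_of_diffOp_qElt_pow_qElt_pow_mul hs hq he hD hdec (r := r) hg ?_
  refine symPairing_nondegenerate hs he t _ ?_ fun b hb => ?_
  · refine diffOp_mem_symPart q t (2 * r) (symPart_pow_mem (qElt_mem_symPart hq he) r) ?_
    rw [add_comm]
    exact qElt_pow_mul_mem hq he hg r
  · have h1 := hf' t rfl b hb
    rw [symPairing_add_left, symPairing_fSpan hs hq he hD hl hb, zero_add, symPairing_comm hs,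
      mul_comm _ b, symPairing_mul] at h1
    exact h1

variable {V : Type*} [AddCommGroup V] [Module k V] [FiniteDimensional k V]
variable [Module (Cl q) V] [IsScalarTower k (Cl q) V] {τ : LinearMap.BilinForm k V}

theorem fSpan_le_ker [CharZero k] [IsAlgClosed k] (hs : q.IsSymm) (hq : q.Nondegenerate)
    (he : ∀ i j, q (e i) (e j) = if i = j then 1 else 0) (hD : 0 < Fintype.card ι)
    (hτs : τ.IsSymm) (hτi : IsClInvariant q τ) {n : ℕ} (hn : finrank k V = 4 * n) :
    fSpan q hq n ≤ (RingHom.ker (symToA q τ)).restrictScalars k := by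
  rcases Nat.lt_or_ge 1 (Fintype.card ι) with hD2 | hD1
  · exact (fSpan_le_isotropicIdeal hs hq he hD2 n).trans (isotropicIdeal_le_ker hτs hτi hn)
  obtain ⟨i, hi⟩ := Fintype.card_eq_one_iff.1 (le_antisymm hD1 hD)
  refine Submodule.span_le.2 ?_
  rintro _ ⟨j, d, hjd, p, hp, rfl⟩
  rcases le_or_gt d 1 with hd | hd
  · exact symToA_eq_zero_of_lt hn (by omega : 2 * n < 2 * j + d)
      (qElt_pow_mul_mem hq he (genPart_le_symPart q d hp) j)
  · -- on a line, there are no isotropic vectors but zero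
    have h0 : genPart q d = ⊥ := by
      refine Submodule.span_eq_bot.2 ?_
      rintro _ ⟨x, hx, rfl⟩
      have hx := hx.resolve_right (by omega)
      have hu : (Finset.univ : Finset ι) = {i} := by ext j; simp [hi j]
      have h1 := sum_smul_orthonormal he x
      rw [hu, Finset.sum_singleton] at h1
      rw [← h1] at hx
      have h2 : q (e i) x = 0 := by simpa [he] using hx
      rw [← h1, h2, zero_smul, map_zero, zero_pow (by omega)]
    rw [h0, Submodule.mem_bot] at hp
    simp [hp]

/-- The power `q^n` is not in the kernel, since it spans `S^{2n} H` modulo `fSpan q hq n` and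
`ω_x^{2n} ≠ 0` for a unit vector `x`. -/
theorem symToA_qElt_pow_ne_zero [CharZero k] [IsAlgClosed k] (hs : q.IsSymm)
    (hq : q.Nondegenerate)
    (he : ∀ i j, q (e i) (e j) = if i = j then 1 else 0) (hD : 0 < Fintype.card ι)
    (hτs : τ.IsSymm) (hτ : τ.Nondegenerate) (hτi : IsClInvariant q τ) {n : ℕ}
    (hn : finrank k V = 4 * n) : symToA q τ (qElt q hq ^ n) ≠ 0 := by
  intro h0
  obtain ⟨i⟩ := Fintype.card_pos_iff.1 hD
  have h1 := ι_pow_mem_symPart (k := k) (e i) (0 + 2 * n)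
  obtain ⟨l, hl, g, -, hg⟩ :=
    exists_eq_add_qElt_pow_mul hq he (symPart_le_genPart_sup hs hq he hD) h1
  rw [zero_add] at hl hg
  have h2 : symToA q τ l = 0 := fSpan_le_ker hs hq he hD hτs hτi hn hl
  have h3 := congrArg (symToA q τ) hg
  rw [map_add, h2, map_mul, h0, zero_mul, add_zero, map_pow] at h3
  refine phi_pow_ne_zero hτs hτ hτi hn (x := e i) (by simp [he]) ?_
  rw [← coe_symToA_ι, ← SubmonoidClass.coe_pow, h3]
  rfl

/-- The kernel does not meet `q^r S^t H` if `t + r ≤ n`: otherwise it would contain an element of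
degree `2n` not orthogonal to `q^n`, and hence `q^n`. -/
theorem eq_zero_of_symToA_qElt_pow_mul [CharZero k] [IsAlgClosed k] (hs : q.IsSymm)
    (hq : q.Nondegenerate)
    (he : ∀ i j, q (e i) (e j) = if i = j then 1 else 0) (hD : 0 < Fintype.card ι)
    (hτs : τ.IsSymm) (hτ : τ.Nondegenerate) (hτi : IsClInvariant q τ) {n : ℕ}
    (hn : finrank k V = 4 * n) {t r : ℕ} (htr : t + r ≤ n) {g : SymmetricAlgebra k H}
    (hg : g ∈ symPart k H t) (h0 : symToA q τ (qElt q hq ^ r * g) = 0) : g = 0 := by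
  have hdec := symPart_le_genPart_sup hs hq he hD
  have hQg := qElt_pow_mul_mem hq he hg r
  have hQn := symPart_pow_mem (qElt_mem_symPart hq he) n
  refine eq_zero_of_diffOp_qElt_pow hs hq he hD hdec htr hg ?_
  refine symPairing_nondegenerate hs he (2 * n - (2 * r + t)) _ (diffOp_mem_symPart q _ _ hQg
    (by rwa [show 2 * n - (2 * r + t) + (2 * r + t) = 2 * n by omega])) fun b hb => ?_
  rw [← symPairing_mul]
  have h1 := symPart_mul_mem hb hQg
  rw [show 2 * n - (2 * r + t) + (2 * r + t) = 0 + 2 * n by omega] at h1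
  obtain ⟨l, hl, c, hc, hlc⟩ := exists_eq_add_qElt_pow_mul hq he hdec h1
  rw [zero_add] at hl
  have h2 : symToA q τ l = 0 := fSpan_le_ker hs hq he hD hτs hτi hn hl
  rw [symPart_zero] at hc
  obtain ⟨c, rfl⟩ := Submodule.mem_one.1 hc
  have h3 := congrArg (symToA q τ) hlc
  rw [map_mul, h0, mul_zero, map_add, h2, zero_add, mul_comm, ← Algebra.smul_def, map_smul] at h3
  have h4 := (smul_eq_zero.1 h3.symm).resolve_right
    (symToA_qElt_pow_ne_zero hs hq he hD hτs hτ hτi hn)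
  rw [hlc, h4, map_zero, mul_zero, add_zero, ← mul_one (qElt q hq ^ n)]
  refine symPairing_fSpan (t := 0) hs hq he hD (by rwa [zero_add]) ?_
  rw [symPart_zero]
  exact Submodule.one_le.1 le_rfl

theorem ker_le_fSpan [CharZero k] [IsAlgClosed k] (hs : q.IsSymm) (hq : q.Nondegenerate)
    (he : ∀ i j, q (e i) (e j) = if i = j then 1 else 0) (hD : 0 < Fintype.card ι)
    (hτs : τ.IsSymm) (hτ : τ.Nondegenerate) (hτi : IsClInvariant q τ) {n : ℕ}
    (hn : finrank k V = 4 * n) :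
    (RingHom.ker (symToA q τ)).restrictScalars k ≤ fSpan q hq n := by
  have hdec := symPart_le_genPart_sup hs hq he hD
  intro s h0
  obtain ⟨c, hc, rfl⟩ := exists_finsupp_symPart s
  refine Submodule.sum_mem _ fun m _ => ?_
  have hm : symToA q τ (c m) = 0 := by
    refine symToA_eq_zero_of_sum_mem q τ hc (j := 1) ?_ (by omega)
    rw [show symToA q τ (∑ i ∈ c.support, c i) = 0 from h0]
    exact zero_mem _
  rcases le_or_gt m n with h | h
  · rw [eq_zero_of_symToA_qElt_pow_mul hs hq he hD hτs hτ hτi hn (r := 0) h (hc m) (by simpa)]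
    exact zero_mem _
  rcases le_or_gt m (2 * n) with h' | h'
  · obtain ⟨r, rfl⟩ := Nat.exists_eq_add_of_lt h
    obtain ⟨t, rfl⟩ : ∃ t, n = t + (r + 1) := ⟨n - (r + 1), by omega⟩
    have hf := hc (t + (r + 1) + r + 1)
    rw [show symPart k H (t + (r + 1) + r + 1) = symPart k H (t + 2 * (r + 1)) by
      congr 1; ring] at hf
    obtain ⟨l, hl, g, hg, hlg⟩ := exists_eq_add_qElt_pow_mul hq he hdec hf
    have h2 : symToA q τ l = 0 := fSpan_le_ker hs hq he hD hτs hτi hn hl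
    rw [hlg, map_add, h2, zero_add] at hm
    rw [hlg, eq_zero_of_symToA_qElt_pow_mul hs hq he hD hτs hτ hτi hn le_rfl hg hm]
    simpa using hl
  · exact mem_fSpan_of_lt hq hdec h' (hc m)

theorem fIdeal_eq_ker_of_pos [CharZero k] [IsAlgClosed k] (hs : q.IsSymm) (hq : q.Nondegenerate)
    (he : ∀ i j, q (e i) (e j) = if i = j then 1 else 0) (hD : 0 < Fintype.card ι)
    (hτs : τ.IsSymm) (hτ : τ.Nondegenerate) (hτi : IsClInvariant q τ) {n : ℕ}
    (hn : finrank k V = 4 * n) : fIdeal q hq n = RingHom.ker (symToA q τ) := by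
  refine le_antisymm (Ideal.span_le.2 (Set.iUnion_subset fun r => ?_)) ?_
  · exact (R_subset_fSpan hs hq he hD (symPart_le_genPart_sup hs hq he hD) n r).trans
      (fSpan_le_ker hs hq he hD hτs hτi hn)
  · exact fun s hs' => fSpan_le_fIdeal hs hq he hD n (ker_le_fSpan hs hq he hD hτs hτ hτi hn hs')

end Comparison

/-! ### The case `H = 0` -/

section Trivial

variable {k : Type*} [Field k] {H : Type*} [AddCommGroup H] [Module k H] [Subsingleton H]

theorem exists_algebraMap_eq (s : SymmetricAlgebra k H) : ∃ r : k, algebraMap k _ r = s := by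
  induction s using SymmetricAlgebra.induction with
  | algebraMap r => exact ⟨r, rfl⟩
  | ι x => exact ⟨0, by rw [Subsingleton.elim x 0, map_zero, map_zero]⟩
  | add a b ha hb =>
    obtain ⟨r, rfl⟩ := ha
    obtain ⟨s, rfl⟩ := hb
    exact ⟨r + s, map_add _ _ _⟩
  | mul a b ha hb =>
    obtain ⟨r, rfl⟩ := ha
    obtain ⟨s, rfl⟩ := hb
    exact ⟨r * s, map_mul _ _ _⟩

theorem symPart_succ_eq_bot (m : ℕ) : symPart k H (m + 1) = ⊥ := by
  refine le_bot_iff.1 (symPart_succ_le fun x a _ => ?_)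
  rw [Subsingleton.elim x 0, map_zero, zero_mul]
  exact zero_mem _

/-- If `H = 0`, then only the constants can contribute to the ideal, in the case `n = r = 0`; but
they are orthogonal to `S^0 H` only if they vanish. -/
theorem fIdeal_eq_bot [FiniteDimensional k H] (q : LinearMap.BilinForm k H) (hq : q.Nondegenerate)
    (n : ℕ) : fIdeal q hq n = ⊥ := by
  refine Ideal.span_eq_bot.2 fun f hf => ?_
  obtain ⟨r, hf, hf'⟩ := Set.mem_iUnion.1 hf
  rcases Nat.eq_zero_or_pos (n + r) with h | h
  · obtain ⟨rfl, rfl⟩ : n = 0 ∧ r = 0 := by omega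
    obtain ⟨c, rfl⟩ := exists_algebraMap_eq f
    have h1 := hf' 0 rfl 1 (by rw [symPart_zero]; exact Submodule.one_le.1 le_rfl)
    rw [pow_zero, mul_one, symPairing_one_right] at h1
    rw [show c = 0 by simpa using h1, map_zero]
  · obtain ⟨m, hm⟩ := Nat.exists_eq_add_of_lt h
    rwa [hm, symPart_succ_eq_bot, Submodule.mem_bot] at hf

theorem isotropicIdeal_eq_bot (q : LinearMap.BilinForm k H) (n : ℕ) : isotropicIdeal q n = ⊥ := by
  refine Ideal.span_eq_bot.2 ?_
  rintro _ ⟨x, -, rfl⟩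
  rw [Subsingleton.elim x 0, map_zero, zero_pow n.succ_ne_zero]

end Trivial

/-! ### The isomorphism -/

section Main

variable {k : Type*} [Field k]
variable {H : Type*} [AddCommGroup H] [Module k H] [FiniteDimensional k H]
variable {q : LinearMap.BilinForm k H}
variable {V : Type*} [AddCommGroup V] [Module k V] [FiniteDimensional k V]
variable [Module (Cl q) V] [IsScalarTower k (Cl q) V] {τ : LinearMap.BilinForm k V}

variable (τ) in
/-- The isomorphism `F_n^•(H) ≃ A^•`. -/
def fAlgebraEquiv (hq : q.Nondegenerate) {n : ℕ} (h : fIdeal q hq n = RingHom.ker (symToA q τ)) :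
    FAlgebra q hq n ≃ₐ[k] subalgebraA q τ :=
  (Ideal.quotientEquivAlgOfEq k h).trans
    (Ideal.quotientKerAlgEquivOfSurjective (symToA_surjective q τ))

theorem mem_fPart_iff (hq : q.Nondegenerate) {n : ℕ}
    (h : fIdeal q hq n = RingHom.ker (symToA q τ)) (j : ℕ) (a : FAlgebra q hq n) :
    a ∈ fPart q hq n j ↔
      (fAlgebraEquiv τ hq h a : ExteriorAlgebra k (Dual k V)) ∈ ⋀[k]^j (Dual k V) := by
  constructor
  · intro ha
    rw [fPart] at ha
    split_ifs at ha with hj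
    · obtain ⟨s, hs, rfl⟩ := ha
      have h1 := coe_symToA_mem q τ _ hs
      rwa [Nat.two_mul_div_two_of_even hj] at h1
    · rw [(Submodule.mem_bot k).1 ha, map_zero]
      exact zero_mem _
  · intro ha
    obtain ⟨s, rfl⟩ := Ideal.Quotient.mk_surjective a
    obtain ⟨c, hc, rfl⟩ := exists_finsupp_symPart s
    rw [map_sum]
    refine Submodule.sum_mem _ fun i _ => ?_
    by_cases hi : 2 * i = j
    · rw [fPart, if_pos (by rw [← hi]; exact even_two_mul i), ← hi,
        Nat.mul_div_cancel_left i two_pos]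
      exact Submodule.mem_map_of_mem (hc i)
    · have h1 : Ideal.Quotient.mk (fIdeal q hq n) (c i) = 0 := by
        rw [Ideal.Quotient.eq_zero_iff_mem, h, RingHom.mem_ker]
        exact symToA_eq_zero_of_sum_mem q τ hc ha hi
      rw [h1]
      exact zero_mem _

variable [CharZero k] [IsAlgClosed k]

theorem fIdeal_eq_ker (hs : q.IsSymm) (hq : q.Nondegenerate)
    (hτs : τ.IsSymm) (hτ : τ.Nondegenerate) (hτi : IsClInvariant q τ) {n : ℕ}
    (hn : finrank k V = 4 * n) : fIdeal q hq n = RingHom.ker (symToA q τ) := by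
  rcases Nat.eq_zero_or_pos (finrank k H) with h | h
  · have := finrank_zero_iff.1 h
    rw [fIdeal_eq_bot, eq_comm]
    refine (RingHom.injective_iff_ker_eq_bot _).1 ((injective_iff_map_eq_zero _).2 fun s hs => ?_)
    obtain ⟨r, rfl⟩ := exists_algebraMap_eq s
    rw [AlgHom.commutes] at hs
    have h1 : algebraMap k (ExteriorAlgebra k (Dual k V)) r = 0 := congrArg Subtype.val hs
    rw [(ExteriorAlgebra.algebraMap_eq_zero_iff _ r).1 h1, map_zero]
  · obtain ⟨e, he⟩ := exists_orthonormal_basis hs hq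
    exact fIdeal_eq_ker_of_pos hs hq he (by simpa using h) hτs hτ hτi hn

theorem fIdeal_eq_isotropicIdeal (hs : q.IsSymm) (hq : q.Nondegenerate)
    (hτs : τ.IsSymm) (hτ : τ.Nondegenerate) (hτi : IsClInvariant q τ) {n : ℕ}
    (hn : finrank k V = 4 * n) (hH : finrank k H ≠ 1) : fIdeal q hq n = isotropicIdeal q n := by
  rcases Nat.eq_zero_or_pos (finrank k H) with h | h
  · have := finrank_zero_iff.1 h
    rw [fIdeal_eq_bot, isotropicIdeal_eq_bot]
  · obtain ⟨e, he⟩ := exists_orthonormal_basis hs hq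
    have hD : 2 ≤ Fintype.card (Fin (finrank k H)) := by rw [Fintype.card_fin]; omega
    rw [fIdeal_eq_ker hs hq hτs hτ hτi hn]
    refine le_antisymm (fun s hs' => ?_) (isotropicIdeal_le_ker hτs hτi hn)
    exact fSpan_le_isotropicIdeal hs hq he hD n
      (ker_le_fSpan hs hq he (by omega) hτs hτ hτi hn hs')

end Main

end FAlg

end

theorem mainTheorem4 {k : Type*} [Field k] [CharZero k] [IsAlgClosed k]
    {H : Type*} [AddCommGroup H] [Module k H] [FiniteDimensional k H]
    (q : LinearMap.BilinForm k H) (hq_symm : q.IsSymm) (hq : q.Nondegenerate)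
    {V : Type*} [AddCommGroup V] [Module k V] [FiniteDimensional k V]
    [Module (FAlg.Cl q) V] [IsScalarTower k (FAlg.Cl q) V]
    (τ : LinearMap.BilinForm k V) (hτ_symm : τ.IsSymm) (hτ : τ.Nondegenerate)
    (hτ_inv : FAlg.IsClInvariant q τ)
    (n : ℕ) (hn : Module.finrank k V = 4 * n) :
    (∃ e : FAlg.FAlgebra q hq n ≃ₐ[k] FAlg.subalgebraA q τ,
      (∀ x : H, (e (Ideal.Quotient.mk (FAlg.fIdeal q hq n) (SymmetricAlgebra.ι k H x)) :
          ExteriorAlgebra k (Module.Dual k V)) = FAlg.phi q τ x) ∧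
      (∀ (j : ℕ) (a : FAlg.FAlgebra q hq n), a ∈ FAlg.fPart q hq n j ↔
          (e a : ExteriorAlgebra k (Module.Dual k V)) ∈ ⋀[k]^j (Module.Dual k V))) ∧
    (Module.finrank k H ≠ 1 → FAlg.fIdeal q hq n = FAlg.isotropicIdeal q n) :=
  have h := FAlg.fIdeal_eq_ker hq_symm hq hτ_symm hτ hτ_inv hn
  ⟨⟨FAlg.fAlgebraEquiv τ hq h, fun x => FAlg.coe_symToA_ι q τ x, FAlg.mem_fPart_iff hq h⟩,
    FAlg.fIdeal_eq_isotropicIdeal hq_symm hq hτ_symm hτ hτ_inv hn⟩
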